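/- **Model.** There are $n$ users, the vertices of an unknown simple undirected graph $G$ on $V=\{1,\dots,n\}$, and a server. The private data of user $v$ is its neighborhood $N_v$ in $G$. Interaction proceeds in synchronous rounds. In each round every user sends the server a message (a finite binary string), computed with fresh independent randomness from its local memory and the transcript of all messages of the preceding rounds, and may rewrite its local memory; then the server broadcasts a message, computed with fresh randomness from the transcript so far. The interaction ends when the server sends the empty string. Initially the local memory of $v$ holds $v$ and $N_v$. A *local mechanism* for $n$ users specifies these randomized algorithms, together with a function that reads estimates $\tilde k(v)\in\mathbb R$, $v\in V$, off the complete transcript. It is *memoryless* if no user ever changes its local memory. It is *$\varepsilon$-edge differentially private* if, for any two graphs $G,G'$ on $V$ that differ in at most one edge and any set $S$ of transcripts, $\Pr[\text{transcript on }G\in S]\le e^{\varepsilon}\Pr[\text{transcript on }G'\in S]$. The *coreness* $k(v)$ of $v$ in $G$ is the largest integer $k$ such that some subgraph $H$ of $G$ containing $v$ satisfies $\deg_H(u)\ge k$ for every $u\in V(H)$. **Theorem.** There is an absolute constant $A>0$, and for every $c>0$ there is a constant $B>0$ depending only on $c$, such that the following holds. For every $\eta>0$ there is $n_0$ (depending on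 $c$ and $\eta$ only) such that for every $\varepsilon>0$ there are memoryless local $\varepsilon$-edge differentially private mechanisms $\mathcal M_n$, one for each number $n$ of users, with the following properties for all $n\ge n_0$ and every $n$-vertex graph $G$: * every execution of $\mathcal M_n$ on $G$ ends within $A\,\log_{1+\eta} n\cdot\log n$ rounds, and * with probability at least $1-n^{-c}$, the estimates of $\mathcal M_n$ on $G$ satisfy, simultaneously for all vertices $v$, $$k(v)-\alpha\;\le\;\tilde k(v)\;\le\;(2+\eta)\,k(v)+\alpha,\qquad\text{where}\quad \alpha = B\,\varepsilon^{-1}\,\log n\,\log\log_{1+\eta} n .$$ -/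

import Mathlib

/-! Coreness in a finite graph, and interactive mechanisms in the local model of
edge differential privacy. -/

namespace LocalDP

/-- The coreness of `v` in `G`: the largest `k` such that some subgraph `H` of `G` containing `v`
has all its (induced) degrees at least `k`. The set below contains `0`, and on a finite vertex
type it is bounded, so the supremum is a maximum. -/
noncomputable def coreness {V : Type} (G : SimpleGraph V) (v : V) : ℕ :=
  sSup {k : ℕ | ∃ H : G.Subgraph, v ∈ H.verts ∧ ∀ u ∈ H.verts, k ≤ (H.neighborSet u).ncard}

/-- Two graphs on the same vertices are neighboring if they differ in at most one edge. -/
def EdgeNeighboring {V : Type} (G G' : SimpleGraph V) : Prop :=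
  (symmDiff G.edgeSet G'.edgeSet).encard ≤ 1

/-- Messages are finite binary strings. -/
abbrev Message : Type := List Bool

/-- The local memory of a user: its name, its private data (a set of neighbors), and a
binary string. All three components may be read and overwritten by a mechanism. -/
abbrev Memory (n : ℕ) : Type := Fin n × Set (Fin n) × List Bool

/-- What is sent in one round: a message of every user, then the broadcast of the server. -/
abbrev RoundMessages (n : ℕ) : Type := (Fin n → Message) × Message

/-- A transcript: the messages of all rounds so far, in chronological order. -/
abbrev Transcript (n : ℕ) : Type := List (RoundMessages n)

/-- A transcript is complete if it has a last round and in that round the server sent the empty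
string, which ends the interaction. -/
def Transcript.IsComplete {n : ℕ} (τ : Transcript n) : Prop :=
  ∃ r : RoundMessages n, τ.getLast? = some r ∧ r.2 = []

/-- Independent draws `x 0, …, x (n - 1)`, where `x i` has law `p i`. -/
noncomputable def drawAll {α : Type} : (n : ℕ) → (Fin n → PMF α) → PMF (Fin n → α)
  | 0, _ => PMF.pure (fun i => i.elim0)
  | n + 1, p =>
      (p 0).bind fun a => (drawAll n fun i => p i.succ).map fun x => Fin.cons a x

/-- A local mechanism for `n` users and a server. The randomized algorithms are given by the laws
of what they return:
* `user τ ℓ` is the law of the message and the new local memory of a user with local memory `ℓ`,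
  when the transcript of the preceding rounds is `τ`;
* `server τ σ` is the law of the message of the server, when the transcript of the preceding
  rounds is `τ` and the users have just sent `σ`;
* `output τ v` is the estimate that the server reports for user `v` at the end of an interaction
  with complete transcript `τ`. -/
structure LocalMechanism (n : ℕ) where
  user : Transcript n → Memory n → PMF (Message × Memory n)
  server : Transcript n → (Fin n → Message) → PMF Message
  output : Transcript n → Fin n → ℝ

namespace LocalMechanism

variable {n : ℕ}

/-- A mechanism is memoryless if no user ever changes its local memory. -/
def IsMemoryless (M : LocalMechanism n) : Prop :=
  ∀ (τ : Transcript n) (ℓ : Memory n), ∀ x ∈ (M.user τ ℓ).support, x.2 = ℓ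

open Classical in
/-- One round, from a transcript and the local memories of all users: the users draw messages and
new memories, independently of each other, and then the server draws its message. Nothing happens
when the interaction has already ended. -/
noncomputable def step (M : LocalMechanism n) (s : Transcript n × (Fin n → Memory n)) :
    PMF (Transcript n × (Fin n → Memory n)) :=
  if s.1.IsComplete then PMF.pure s
  else
    (drawAll n fun v => M.user s.1 (s.2 v)).bind fun x =>
      (M.server s.1 fun v => (x v).1).map fun m =>
        (s.1 ++ [(fun v => (x v).1, m)], fun v => (x v).2)

/-- The execution on the input graph `G`, stopped after `t` rounds if it has not ended before.
Initially the transcript is empty and user `v` holds `v` and its neighbors in `G`. -/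
noncomputable def run (M : LocalMechanism n) (G : SimpleGraph (Fin n)) :
    ℕ → PMF (Transcript n × (Fin n → Memory n))
  | 0 => PMF.pure ([], fun v => (v, G.neighborSet v, []))
  | t + 1 => (M.run G t).bind M.step

/-- The law of the transcript of the execution on `G`, stopped after `t` rounds if it has not
ended before. -/
noncomputable def transcriptLaw (M : LocalMechanism n) (G : SimpleGraph (Fin n)) (t : ℕ) :
    PMF (Transcript n) :=
  (M.run G t).map Prod.fst

/-- `ε`-edge differential privacy of the transcript: on neighboring input graphs the probabilities
of every set of transcripts agree up to the factor `exp ε`. Executions need not end, so the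
condition is imposed on the transcript up to every round `t`; for a mechanism whose executions
all end within `R` rounds, the case `t = R` is about the complete transcript. -/
def IsEdgeDP (M : LocalMechanism n) (ε : ℝ) : Prop :=
  ∀ G G' : SimpleGraph (Fin n), EdgeNeighboring G G' →
    ∀ (t : ℕ) (S : Set (Transcript n)),
      (M.transcriptLaw G t).toOuterMeasure S ≤
        ENNReal.ofReal (Real.exp ε) * (M.transcriptLaw G' t).toOuterMeasure S

/-- Every execution, on any input graph, ends after at most `R` rounds. -/
def RunsWithin (M : LocalMechanism n) (R : ℕ) : Prop :=
  ∀ (G : SimpleGraph (Fin n)), ∀ τ ∈ (M.transcriptLaw G R).support, τ.IsComplete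

end LocalMechanism

end LocalDP

namespace LocalDP

open scoped ENNReal

/-! ### Expectations under probability mass functions -/

/-! Each vertex determines its coreness by binary search over the thresholds `lam ^ j / 4`, `j < 2 ^
L`. A search index `b` at stage `s` stands for the exponents in `[b * 2 ^ (L - s), (b + 1) * 2 ^ (L
- s))`, and the midpoint is tested by `R` rounds of peeling: a vertex stays alive while its noisy
count of neighbors that are ahead in the search, or alive at the same index, reaches the threshold.

Suppose that all counts are correct up to `a`. A subgraph of large minimum degree keeps itself alive
(`div_le_searchIndex`). Conversely, vertices of coreness at most `k` have average relevant degree at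
most `2 * k` (`sum_degree_le`), so at a threshold above `2 * (1 + γ) * k + a` each round shrinks
their number by the factor `1 + γ`, and `R` of order `log n` rounds remove them all
(`searchIndex_lt_of_coreness_le`). This is the source of the factor `2 + η`.

For privacy, an edge matters only through the two indicators of whether an endpoint counts the
other. Within a stage these can only drop, so their total variation is at most `2 * L`, however many
rounds there are (`sum_abs_sub_le`). Hence users release noisy increments of their counts. Summing
all increments would accumulate too much noise over about `(log n) ^ 2` rounds; the two-level
`chain` at most doubles the variation and rebuilds each count from `O(log n)` increments. Total
sensitivity is `8 * L` (`sensitivity_searchQueries_le`), with `L` of order `log log n`.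

The noise has exponential moment at most `2` at rate `β = ε / (16 * L)`, so a sum of `O(log n)`
noises is `O(log n / β)` with high probability, also for adaptive queries
(`tsum_noisyQueries_prod_le`). A union bound over users and rounds gives `a` of order `ε⁻¹ * log n *
log log n`. -/

theorem tsum_bind_mul {α β : Type*} (p : PMF α) (k : α → PMF β) (g : β → ℝ≥0∞) :
    ∑' b, p.bind k b * g b = ∑' a, p a * ∑' b, k a b * g b := by
  simp_rw [PMF.bind_apply, ← ENNReal.tsum_mul_right, ← ENNReal.tsum_mul_left]
  rw [ENNReal.tsum_comm]
  simp_rw [mul_assoc]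

theorem tsum_pure_mul {α : Type*} (a : α) (g : α → ℝ≥0∞) :
    ∑' b, PMF.pure a b * g b = g a := by
  rw [tsum_eq_single a]
  · simp
  · intro b hb
    simp [PMF.pure_apply, hb]

theorem tsum_map_mul {α β : Type*} (p : PMF α) (f : α → β) (g : β → ℝ≥0∞) :
    ∑' b, p.map f b * g b = ∑' a, p a * g (f a) := by
  rw [← PMF.bind_pure_comp, tsum_bind_mul]
  simp

theorem toOuterMeasure_eq_tsum {α : Type*} (p : PMF α) (S : Set α) :
    p.toOuterMeasure S = ∑' a, p a * S.indicator 1 a := by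
  rw [PMF.toOuterMeasure_apply]
  refine tsum_congr fun a => ?_
  by_cases h : a ∈ S <;> simp [h]

/-- Markov's inequality in the form used for the union bound: `F` dominates the indicator of the bad
event. -/
theorem one_sub_le_toOuterMeasure {α : Type*} (p : PMF α) (S : Set α) (F : α → ℝ≥0∞)
    (δ : ℝ≥0∞) (hF : ∑' a, p a * F a ≤ δ) (h : ∀ a ∈ p.support, a ∉ S → 1 ≤ F a) :
    1 - δ ≤ p.toOuterMeasure S := by
  rw [tsub_le_iff_right, toOuterMeasure_eq_tsum]
  calc (1 : ℝ≥0∞) = ∑' a, p a := p.tsum_coe.symm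
    _ ≤ ∑' a, (p a * S.indicator 1 a + p a * F a) := by
        refine ENNReal.tsum_le_tsum fun a => ?_
        by_cases hp : a ∈ p.support
        · by_cases ha : a ∈ S
          · simp [ha]
          · simpa [ha] using mul_le_mul_right (h a hp ha) (p a)
        · rw [PMF.mem_support_iff, not_not] at hp
          simp [hp]
    _ = _ := ENNReal.tsum_add
    _ ≤ _ := by gcongr

theorem bind_apply_le_mul {α β : Type*} {p p' : PMF α} {k k' : α → PMF β} (b : β) (c : ℝ≥0∞)
    (h : ∀ a, p a * k a b ≤ c * (p' a * k' a b)) : p.bind k b ≤ c * p'.bind k' b := by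
  rw [PMF.bind_apply, PMF.bind_apply, ← ENNReal.tsum_mul_left]
  exact ENNReal.tsum_le_tsum h

theorem map_apply_le_mul {α β : Type*} {p p' : PMF α} (f : α → β) (b : β) (c : ℝ≥0∞)
    (h : ∀ a, f a = b → p a ≤ c * p' a) : p.map f b ≤ c * p'.map f b := by
  rw [← PMF.bind_pure_comp, ← PMF.bind_pure_comp]
  refine bind_apply_le_mul b c fun a => ?_
  by_cases hb : b = f a
  · simpa [PMF.pure_apply, hb] using h a hb.symm
  · simp [PMF.pure_apply, hb]

/-! ### Independent draws -/

theorem drawAll_map {α β : Type} : ∀ (n : ℕ) (p : Fin n → PMF α) (f : Fin n → α → β),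
    (drawAll n fun i => (p i).map (f i)) = (drawAll n p).map fun x i => f i (x i)
  | 0, _, _ => by
      simp only [drawAll, PMF.pure_map]
      congr 1
      funext i
      exact i.elim0
  | n + 1, p, f => by
      simp only [drawAll, PMF.map_bind, PMF.bind_map, PMF.map_comp,
        drawAll_map n (fun i => p i.succ) (fun i => f i.succ)]
      congr 1
      funext a
      simp only [Function.comp_apply]
      congr 1
      funext x
      funext i
      refine Fin.cases ?_ (fun j => ?_) i <;> simp

theorem drawAll_map_eval {α : Type} : ∀ (n : ℕ) (p : Fin n → PMF α) (i : Fin n),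
    (drawAll n p).map (fun x => x i) = p i
  | 0, _, i => i.elim0
  | n + 1, p, i => by
      simp only [drawAll, PMF.map_bind, PMF.map_comp]
      refine Fin.cases ?_ (fun j => ?_) i
      · have : ∀ a : α, ((fun x : Fin (n + 1) → α => x 0) ∘
            fun x : Fin n → α => (Fin.cons a x : Fin (n + 1) → α)) = Function.const _ a := by
          intro a; funext x; simp
        simp only [this, PMF.map_const, PMF.bind_pure]
      · have : ∀ a : α, ((fun x : Fin (n + 1) → α => x j.succ) ∘
            fun x : Fin n → α => (Fin.cons a x : Fin (n + 1) → α)) = fun x => x j := by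
          intro a; funext x; simp
        simp only [this, drawAll_map_eval n (fun i => p i.succ) j, PMF.bind_const]

theorem drawAll_apply {α : Type} : ∀ (n : ℕ) (p : Fin n → PMF α) (x : Fin n → α),
    drawAll n p x = ∏ i, p i (x i)
  | 0, _, x => by
      have : x = fun i => i.elim0 := funext fun i => i.elim0
      simp [drawAll, this]
  | n + 1, p, x => by
      rw [drawAll, PMF.bind_apply, Fin.prod_univ_succ, tsum_eq_single (x 0)]
      · rw [PMF.map_apply, tsum_eq_single (Fin.tail x)]
        · rw [if_pos (Fin.cons_self_tail x).symm, drawAll_apply]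
          rfl
        · intro y hy
          rw [if_neg]
          intro h
          exact hy (by rw [h, Fin.tail_cons])
      · intro a ha
        rw [PMF.map_apply]
        refine mul_eq_zero_of_right _ (ENNReal.tsum_eq_zero.2 fun y => if_neg ?_)
        rintro rfl
        exact ha (by simp)

theorem drawAll_apply_le_mul {α : Type} (n : ℕ) (p p' : Fin n → PMF α) (c : Fin n → ℝ≥0∞)
    (x : Fin n → α) (h : ∀ i, p i (x i) ≤ c i * p' i (x i)) :
    drawAll n p x ≤ (∏ i, c i) * drawAll n p' x := by
  rw [drawAll_apply, drawAll_apply, ← Finset.prod_mul_distrib]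
  exact Finset.prod_le_prod' fun i _ => h i

/-! ### The discrete Laplace distribution -/

theorem hasSum_pow_natAbs {r : ℝ} (h0 : 0 ≤ r) (h1 : r < 1) :
    HasSum (fun z : ℤ => r ^ z.natAbs) ((1 + r) / (1 - r)) := by
  have h := hasSum_geometric_of_lt_one h0 h1
  have hr : (1 : ℝ) - r ≠ 0 := by linarith
  have hneg : ∀ k : ℕ, (-((k : ℤ) + 1)).natAbs = k + 1 := fun k => by omega
  have := HasSum.of_nat_of_neg_add_one (f := fun z : ℤ => r ^ z.natAbs)
    (m := (1 - r)⁻¹) (m' := r * (1 - r)⁻¹) (by simpa using h)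
    (by simpa only [hneg, pow_succ'] using h.mul_left r)
  convert this using 1
  field_simp

/-- The discrete Laplace distribution: the mass at `z` is proportional to `s ^ (2 * |z|)`. -/
noncomputable def discreteLaplace (s : ℝ) (h0 : 0 < s) (h1 : s < 1) : PMF ℤ :=
  ⟨fun z => ENNReal.ofReal ((1 - s ^ 2) / (1 + s ^ 2) * (s ^ 2) ^ z.natAbs), by
    have hs : s ^ 2 < 1 := by nlinarith
    have h := (hasSum_pow_natAbs (sq_nonneg s) hs).mul_left ((1 - s ^ 2) / (1 + s ^ 2))
    have hc : (1 - s ^ 2) / (1 + s ^ 2) * ((1 + s ^ 2) / (1 - s ^ 2)) = 1 := by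
      have : (1 : ℝ) - s ^ 2 ≠ 0 := by linarith
      have : (1 : ℝ) + s ^ 2 ≠ 0 := by positivity
      field_simp
    rw [hc] at h
    have hn : ∀ z : ℤ, 0 ≤ (1 - s ^ 2) / (1 + s ^ 2) * (s ^ 2) ^ z.natAbs := fun z =>
      mul_nonneg (div_nonneg (by linarith) (by positivity)) (by positivity)
    have := ENNReal.ofReal_tsum_of_nonneg hn h.summable
    rw [h.tsum_eq, ENNReal.ofReal_one] at this
    rw [this]
    exact ENNReal.summable.hasSum⟩

theorem discreteLaplace_apply (s : ℝ) (h0 : 0 < s) (h1 : s < 1) (z : ℤ) :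
    discreteLaplace s h0 h1 z
      = ENNReal.ofReal ((1 - s ^ 2) / (1 + s ^ 2) * (s ^ 2) ^ z.natAbs) := rfl

theorem discreteLaplace_apply_le_mul (s : ℝ) (h0 : 0 < s) (h1 : s < 1) (z w : ℤ) :
    discreteLaplace s h0 h1 z
      ≤ ENNReal.ofReal (((s ^ 2)⁻¹) ^ (z - w).natAbs) * discreteLaplace s h0 h1 w := by
  rw [discreteLaplace_apply, discreteLaplace_apply, ← ENNReal.ofReal_mul (by positivity)]
  refine ENNReal.ofReal_le_ofReal ?_
  have hs : s ^ 2 < 1 := by nlinarith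
  rw [mul_left_comm]
  refine mul_le_mul_of_nonneg_left ?_ (div_nonneg (by linarith) (by positivity))
  rw [inv_pow, inv_mul_eq_div, le_div_iff₀ (by positivity), ← pow_add]
  exact pow_le_pow_of_le_one (by positivity) hs.le (by omega)

/-- At half the decay rate the exponential moment is `(1 + s) ^ 2 / (1 + s ^ 2) ≤ 2`. Parametrizing
the law by `s ^ 2` keeps square roots out of this computation. -/
theorem tsum_discreteLaplace_mul_le (s : ℝ) (h0 : 0 < s) (h1 : s < 1) :
    ∑' z, discreteLaplace s h0 h1 z * ENNReal.ofReal (s⁻¹ ^ z.natAbs / 2) ≤ 1 := by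
  have hs : s ^ 2 < 1 := by nlinarith
  have h := (hasSum_pow_natAbs h0.le h1).mul_left ((1 - s ^ 2) / (1 + s ^ 2) / 2)
  have hn : ∀ z : ℤ, 0 ≤ (1 - s ^ 2) / (1 + s ^ 2) / 2 * s ^ z.natAbs := fun z =>
    mul_nonneg (div_nonneg (div_nonneg (by linarith) (by positivity)) (by positivity))
      (by positivity)
  have hterm : ∀ z : ℤ, discreteLaplace s h0 h1 z * ENNReal.ofReal (s⁻¹ ^ z.natAbs / 2)
      = ENNReal.ofReal ((1 - s ^ 2) / (1 + s ^ 2) / 2 * s ^ z.natAbs) := by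
    intro z
    rw [discreteLaplace_apply, ← ENNReal.ofReal_mul
      (mul_nonneg (div_nonneg (by linarith) (by positivity)) (by positivity))]
    congr 1
    have : (s ^ 2) ^ z.natAbs = s ^ z.natAbs * s ^ z.natAbs := by rw [← pow_mul, two_mul, pow_add]
    rw [this, inv_pow]
    have : s ^ z.natAbs ≠ 0 := by positivity
    field_simp
  simp_rw [hterm]
  rw [← ENNReal.ofReal_tsum_of_nonneg hn h.summable, h.tsum_eq]
  refine ENNReal.ofReal_le_one.2 ?_
  have h2 : (1 : ℝ) - s ≠ 0 := by linarith
  have : (1 - s ^ 2) / (1 + s ^ 2) / 2 * ((1 + s) / (1 - s)) = (1 + s) ^ 2 / (2 * (1 + s ^ 2)) := by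
    have : (1 : ℝ) + s ^ 2 ≠ 0 := by positivity
    field_simp
    ring
  rw [this, div_le_one (by positivity)]
  nlinarith [sq_nonneg (1 - s)]

/-! ### Mechanisms in which every user answers a query with additive noise -/

/-- An injective encoding of the integers by binary strings. -/
def encodeInt (z : ℤ) : Message := List.replicate (Equiv.intEquivNat z) true

/-- The decoding for `encodeInt`. -/
def decodeInt (m : Message) : ℤ := Equiv.intEquivNat.symm m.length

@[simp] theorem decodeInt_encodeInt (z : ℤ) : decodeInt (encodeInt z) = z := by
  simp [encodeInt, decodeInt]

/-- The integer that user `v` sent in round `i`. -/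
def answers {n : ℕ} (τ : Transcript n) (i : ℕ) (v : Fin n) : ℤ :=
  decodeInt ((τ.getD i (fun _ => [], [])).1 v)

theorem answers_append_of_lt {n : ℕ} (τ τ' : Transcript n) {i : ℕ} (hi : i < τ.length) :
    answers (τ ++ τ') i = answers τ i := by
  funext v
  rw [answers, answers, List.getD_append _ _ _ _ hi]

theorem answers_append_length {n : ℕ} (τ : Transcript n) (r : RoundMessages n) (v : Fin n) :
    answers (τ ++ [r]) τ.length v = decodeInt (r.1 v) := by
  rw [answers, List.getD_append_right _ _ _ _ le_rfl]
  simp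

/-- Queries that depend on the answers `y` given so far, the round `t`, the user and its data. -/
abbrev Queries (n : ℕ) : Type := (ℕ → Fin n → ℤ) → ℕ → Fin n → Set (Fin n) → ℤ

/-- Queries are causal if they depend only on answers of preceding rounds. -/
def Queries.IsCausal {n : ℕ} (q : Queries n) : Prop :=
  ∀ (y y' : ℕ → Fin n → ℤ) (t : ℕ), (∀ i < t, y i = y' i) → q y t = q y' t

theorem Queries.IsCausal.append {n : ℕ} {q : Queries n} (hq : q.IsCausal) (τ τ' : Transcript n)
    {t : ℕ} (ht : t ≤ τ.length) : q (answers (τ ++ τ')) t = q (answers τ) t :=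
  hq _ _ _ fun _ hi => answers_append_of_lt τ τ' (hi.trans_le ht)

/-- The server's message after the rounds `τ`, in a mechanism that lasts `T` rounds. -/
def ending {n : ℕ} (T : ℕ) (τ : Transcript n) : Message :=
  -- The current round has number `τ.length + 1`, so round `T` is the one that ends the interaction.
  if τ.length + 1 < T then [true] else []

/-- The mechanism with `T` rounds in which every user answers its query with additive noise. -/
noncomputable def noisyQueries {n : ℕ} (T : ℕ) (ν : PMF ℤ) (q : Queries n)
    (out : Transcript n → Fin n → ℝ) : LocalMechanism n where
  user τ ℓ := ν.map fun z => (encodeInt (q (answers τ) τ.length ℓ.1 ℓ.2.1 + z), ℓ)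
  server τ _ := PMF.pure (ending T τ)
  output := out

/-- The law of the users' messages after the transcript `τ`. -/
noncomputable def messagesLaw {n : ℕ} (ν : PMF ℤ) (q : Queries n) (N : Fin n → Set (Fin n))
    (τ : Transcript n) : PMF (Fin n → Message) :=
  drawAll n fun v => ν.map fun z => encodeInt (q (answers τ) τ.length v (N v) + z)

open Classical in
/-- One round of `noisyQueries`, as seen on the transcript. -/
noncomputable def transcriptStep {n : ℕ} (T : ℕ) (ν : PMF ℤ) (q : Queries n)
    (N : Fin n → Set (Fin n)) (τ : Transcript n) : PMF (Transcript n) :=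
  if τ.IsComplete then PMF.pure τ
  else (messagesLaw ν q N τ).map fun σ => τ ++ [(σ, ending T τ)]

section

variable {n : ℕ} (T : ℕ) (ν : PMF ℤ) (q : Queries n) (out : Transcript n → Fin n → ℝ)

theorem noisyQueries_isMemoryless : (noisyQueries T ν q out).IsMemoryless := by
  intro τ ℓ x hx
  simp only [noisyQueries, PMF.mem_support_map_iff] at hx
  obtain ⟨z, -, rfl⟩ := hx
  rfl

theorem noisyQueries_step (G : SimpleGraph (Fin n)) (τ : Transcript n) :
    (noisyQueries T ν q out).step (τ, fun v => (v, G.neighborSet v, []))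
      = (transcriptStep T ν q G.neighborSet τ).map
          fun τ' => (τ', fun v => (v, G.neighborSet v, [])) := by
  unfold LocalMechanism.step transcriptStep
  by_cases h : τ.IsComplete
  · simp [h, PMF.pure_map]
  · have key : (drawAll n fun v => (noisyQueries T ν q out).user τ (v, G.neighborSet v, []))
        = (messagesLaw ν q G.neighborSet τ).map
            fun σ v => (σ v, ((v, G.neighborSet v, []) : Memory n)) := by
      rw [messagesLaw, ← drawAll_map n _ fun v m => (m, ((v, G.neighborSet v, []) : Memory n))]
      simp only [noisyQueries, PMF.map_comp]
      rfl
    simp only [h, if_false, key, PMF.bind_map, PMF.map_comp]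
    simp only [noisyQueries, PMF.pure_map]
    rw [← PMF.bind_pure_comp]
    rfl

/-- Memories never change, so the transcript alone is a Markov chain that carries the whole state.
-/
theorem noisyQueries_run (G : SimpleGraph (Fin n)) (t : ℕ) :
    (noisyQueries T ν q out).run G t
      = ((noisyQueries T ν q out).transcriptLaw G t).map
          fun τ => (τ, fun v => (v, G.neighborSet v, [])) := by
  induction t with
  | zero => simp [LocalMechanism.transcriptLaw, LocalMechanism.run, PMF.pure_map]
  | succ t ih =>
    have h : (noisyQueries T ν q out).run G (t + 1)
        = (((noisyQueries T ν q out).transcriptLaw G t).bind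
            (transcriptStep T ν q G.neighborSet)).map
              fun τ' => (τ', fun v => (v, G.neighborSet v, [])) := by
      rw [LocalMechanism.run, ih, PMF.bind_map, PMF.map_bind]
      congr 1
      funext τ
      exact noisyQueries_step T ν q out G τ
    rw [LocalMechanism.transcriptLaw, h, PMF.map_comp, PMF.map_comp]
    rfl

theorem noisyQueries_transcriptLaw_zero (G : SimpleGraph (Fin n)) :
    (noisyQueries T ν q out).transcriptLaw G 0 = PMF.pure [] := by
  simp [LocalMechanism.transcriptLaw, LocalMechanism.run, PMF.pure_map]

theorem noisyQueries_transcriptLaw_succ (G : SimpleGraph (Fin n)) (t : ℕ) :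
    (noisyQueries T ν q out).transcriptLaw G (t + 1)
      = ((noisyQueries T ν q out).transcriptLaw G t).bind
          (transcriptStep T ν q G.neighborSet) := by
  rw [LocalMechanism.transcriptLaw, LocalMechanism.run, noisyQueries_run, PMF.bind_map,
    PMF.map_bind]
  congr 1
  funext τ
  rw [Function.comp_apply, noisyQueries_step, PMF.map_comp]
  exact PMF.map_id _

theorem isComplete_append_ending (τ : Transcript n) (σ : Fin n → Message) :
    Transcript.IsComplete (τ ++ [(σ, ending T τ)]) ↔ T ≤ τ.length + 1 := by
  simp [Transcript.IsComplete, ending]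

theorem noisyQueries_support (hT : 0 < T) (G : SimpleGraph (Fin n)) (t : ℕ) (ht : t ≤ T) :
    ∀ τ ∈ ((noisyQueries T ν q out).transcriptLaw G t).support,
      τ.length = t ∧ (τ.IsComplete ↔ t = T) := by
  induction t with
  | zero =>
    intro τ hτ
    rw [noisyQueries_transcriptLaw_zero, PMF.mem_support_pure_iff] at hτ
    subst hτ
    simp [Transcript.IsComplete, hT.ne]
  | succ t ih =>
    intro τ hτ
    rw [noisyQueries_transcriptLaw_succ, PMF.mem_support_bind_iff] at hτ
    obtain ⟨τ₀, h₀, hτ⟩ := hτ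
    obtain ⟨hl, hc⟩ := ih (by omega) τ₀ h₀
    have : ¬ τ₀.IsComplete := fun h => by have := hc.1 h; omega
    rw [transcriptStep, if_neg this, PMF.mem_support_map_iff] at hτ
    obtain ⟨σ, -, rfl⟩ := hτ
    refine ⟨by simp [hl], ?_⟩
    rw [isComplete_append_ending, hl]
    omega

theorem noisyQueries_runsWithin (hT : 0 < T) : (noisyQueries T ν q out).RunsWithin T :=
  fun G τ hτ => (noisyQueries_support T ν q out hT G T le_rfl τ hτ).2.2 rfl

/-! ### Privacy -/

/-- The accumulated sensitivity of the queries along a transcript. -/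
noncomputable def sensitivity (N N' : Fin n → Set (Fin n)) (τ : Transcript n) : ℕ :=
  ∑ i ∈ Finset.range τ.length, ∑ v,
    (q (answers τ) i v (N v) - q (answers τ) i v (N' v)).natAbs

variable {q} in
theorem sensitivity_append (hq : q.IsCausal) (N N' : Fin n → Set (Fin n)) (τ : Transcript n)
    (r : RoundMessages n) :
    sensitivity q N N' (τ ++ [r]) = sensitivity q N N' τ
      + ∑ v, (q (answers τ) τ.length v (N v) - q (answers τ) τ.length v (N' v)).natAbs := by
  have : (τ ++ [r]).length = τ.length + 1 := by simp
  rw [sensitivity, this, Finset.sum_range_succ, hq.append τ [r] le_rfl, sensitivity]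
  congr 1
  refine Finset.sum_congr rfl fun i hi => ?_
  rw [hq.append τ [r] (Finset.mem_range.1 hi).le]

variable {ν q} in
theorem messagesLaw_le_mul {ρ : ℝ≥0∞}
    (hν : ∀ z w : ℤ, ν z ≤ ρ ^ (z - w).natAbs * ν w) (N N' : Fin n → Set (Fin n))
    (τ : Transcript n) (σ : Fin n → Message) :
    messagesLaw ν q N τ σ ≤
      ρ ^ (∑ v, (q (answers τ) τ.length v (N v) - q (answers τ) τ.length v (N' v)).natAbs)
        * messagesLaw ν q N' τ σ := by
  rw [← Finset.prod_pow_eq_pow_sum]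
  refine drawAll_apply_le_mul n _ _ _ σ fun v => ?_
  set a := q (answers τ) τ.length v (N v)
  set b := q (answers τ) τ.length v (N' v)
  -- Changing the query from `b` to `a` amounts to translating the noise by `a - b`.
  have hshift : (ν.map fun z => encodeInt (a + z))
      = (ν.map fun z => z + (a - b)).map fun z => encodeInt (b + z) := by
    rw [PMF.map_comp]
    congr 1
    funext z
    simp only [Function.comp_apply]
    congr 1
    ring
  rw [hshift]
  refine map_apply_le_mul _ _ _ fun w _ => ?_
  rw [PMF.map_apply, tsum_eq_single (w - (a - b))]
  · rw [if_pos (by ring)]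
    refine (hν _ w).trans (le_of_eq ?_)
    congr 2
    omega
  · intro z hz
    rw [if_neg]
    omega

-- Adaptive composition: once the transcript is fixed, all queries are determined on both graphs,
-- and the likelihood ratios of the rounds multiply. A pointwise bound suffices because transcripts
-- are discrete.
variable {ν q} in
theorem noisyQueries_apply_le_mul {ρ : ℝ≥0∞}
    (hν : ∀ z w : ℤ, ν z ≤ ρ ^ (z - w).natAbs * ν w) (hq : q.IsCausal)
    (G G' : SimpleGraph (Fin n)) (t : ℕ) (τ : Transcript n) :
    (noisyQueries T ν q out).transcriptLaw G t τ ≤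
      ρ ^ sensitivity q G.neighborSet G'.neighborSet τ
        * (noisyQueries T ν q out).transcriptLaw G' t τ := by
  induction t generalizing τ with
  | zero =>
    simp only [noisyQueries_transcriptLaw_zero, PMF.pure_apply]
    split_ifs with h
    · subst h
      simp [sensitivity]
    · simp
  | succ t ih =>
    simp only [noisyQueries_transcriptLaw_succ]
    refine bind_apply_le_mul τ _ fun τ₀ => ?_
    unfold transcriptStep
    split_ifs with hc
    · rw [PMF.pure_apply]
      split_ifs with h
      · subst h
        simpa using ih τ
      · simp
    · by_cases h : ∃ σ, τ = τ₀ ++ [(σ, ending T τ₀)]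
      · obtain ⟨σ, rfl⟩ := h
        have hm : ∀ H : SimpleGraph (Fin n),
            ((messagesLaw ν q H.neighborSet τ₀).map fun σ => τ₀ ++ [(σ, ending T τ₀)])
              (τ₀ ++ [(σ, ending T τ₀)]) = messagesLaw ν q H.neighborSet τ₀ σ := by
          intro H
          rw [PMF.map_apply, tsum_eq_single σ]
          · simp
          · intro σ' h
            rw [if_neg]
            simpa using h.symm
        rw [hm, hm, sensitivity_append hq, pow_add]
        calc _ ≤ _ := mul_le_mul' (ih τ₀)
              (messagesLaw_le_mul hν G.neighborSet G'.neighborSet τ₀ σ)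
          _ = _ := by ring
      · rw [PMF.map_apply]
        have : ∀ σ, ¬ τ = τ₀ ++ [(σ, ending T τ₀)] := fun σ hσ => h ⟨σ, hσ⟩
        simp [this]

variable {ν q} in
/-- Queries of total sensitivity at most `Δ` give a private mechanism. -/
theorem noisyQueries_isEdgeDP {ρ : ℝ≥0∞} {Δ : ℕ} {ε : ℝ} (h1 : 1 ≤ ρ)
    (hρ : ρ ^ Δ ≤ ENNReal.ofReal (Real.exp ε))
    (hν : ∀ z w : ℤ, ν z ≤ ρ ^ (z - w).natAbs * ν w) (hq : q.IsCausal)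
    (hΔ : ∀ (G G' : SimpleGraph (Fin n)), EdgeNeighboring G G' → ∀ τ,
      sensitivity q G.neighborSet G'.neighborSet τ ≤ Δ) :
    (noisyQueries T ν q out).IsEdgeDP ε := by
  intro G G' hG t S
  rw [toOuterMeasure_eq_tsum, toOuterMeasure_eq_tsum, ← ENNReal.tsum_mul_left]
  refine ENNReal.tsum_le_tsum fun τ => ?_
  rw [← mul_assoc]
  gcongr
  refine (noisyQueries_apply_le_mul T out hν hq G G' t τ).trans ?_
  gcongr
  exact (pow_le_pow_right₀ h1 (hΔ G G' hG τ)).trans hρ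

/-! ### Concentration of the noise -/

-- The product over the rounds played so far is a supermartingale: given the past, the query is
-- fixed by causality and the new noise is fresh, so the new factor has mean at most `1`. The noise
-- terms need not be shown independent.
variable {ν q} in
theorem tsum_noisyQueries_prod_le {h : ℤ → ℝ≥0∞} (hh : ∑' z, ν z * h z ≤ 1) (hq : q.IsCausal)
    (G : SimpleGraph (Fin n)) (v : Fin n) (D : Finset ℕ) (t : ℕ) :
    ∑' τ, (noisyQueries T ν q out).transcriptLaw G t τ *
      ∏ i ∈ D with i < τ.length, h (answers τ i v - q (answers τ) i v (G.neighborSet v)) ≤ 1 := by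
  induction t with
  | zero => simp [noisyQueries_transcriptLaw_zero]
  | succ t ih =>
    rw [noisyQueries_transcriptLaw_succ, tsum_bind_mul]
    refine le_trans (ENNReal.tsum_le_tsum fun τ => ?_) ih
    gcongr
    unfold transcriptStep
    split_ifs with hc
    · rw [tsum_pure_mul]
    · rw [tsum_map_mul]
      set F := ∏ i ∈ D with i < τ.length, h (answers τ i v - q (answers τ) i v (G.neighborSet v))
      set f : Message → ℝ≥0∞ := fun m =>
        if τ.length ∈ D then h (decodeInt m - q (answers τ) τ.length v (G.neighborSet v)) else 1
      have hF : ∀ σ : Fin n → Message,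
          (∏ i ∈ D with i < (τ ++ [(σ, ending T τ)]).length,
            h (answers (τ ++ [(σ, ending T τ)]) i v
              - q (answers (τ ++ [(σ, ending T τ)])) i v (G.neighborSet v))) = F * f (σ v) := by
        intro σ
        have hold : ∏ i ∈ D with i < τ.length, h (answers (τ ++ [(σ, ending T τ)]) i v
              - q (answers (τ ++ [(σ, ending T τ)])) i v (G.neighborSet v)) = F := by
          refine Finset.prod_congr rfl fun i hi => ?_
          have hi := (Finset.mem_filter.1 hi).2
          rw [answers_append_of_lt τ _ hi, hq.append τ _ hi.le]
        by_cases hD : τ.length ∈ D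
        · have : (D.filter fun i => i < (τ ++ [(σ, ending T τ)]).length)
              = insert τ.length (D.filter fun i => i < τ.length) := by
            ext i
            simp only [List.length_append, List.length_singleton, Finset.mem_filter,
              Finset.mem_insert]
            constructor
            · rintro ⟨h1, h2⟩
              by_cases h3 : i = τ.length
              · exact Or.inl h3
              · exact Or.inr ⟨h1, by omega⟩
            · rintro (rfl | ⟨h1, h2⟩)
              · exact ⟨hD, by omega⟩
              · exact ⟨h1, by omega⟩
          rw [this, Finset.prod_insert (by simp), hold, answers_append_length,
            hq.append τ _ le_rfl, mul_comm]
          simp [f, hD]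
        · have : (D.filter fun i => i < (τ ++ [(σ, ending T τ)]).length)
              = D.filter fun i => i < τ.length := by
            refine Finset.filter_congr fun i hi => ?_
            have : i ≠ τ.length := fun h => hD (h ▸ hi)
            simp only [List.length_append, List.length_singleton]
            omega
          rw [this, hold]
          simp [f, hD]
      -- `F` depends on the past only and leaves the sum; what remains is a mean over the current
      -- message of `v`.
      simp_rw [hF, mul_left_comm _ F]
      rw [ENNReal.tsum_mul_left]
      refine mul_le_of_le_one_right zero_le ?_
      rw [← tsum_map_mul (messagesLaw ν q G.neighborSet τ) (fun σ => σ v) f, messagesLaw,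
        drawAll_map_eval, tsum_map_mul]
      by_cases hD : τ.length ∈ D
      · simpa [f, hD] using hh
      · simp [f, hD, ν.tsum_coe]

end

/-! ### Coreness -/

section Coreness

variable {n : ℕ} (G : SimpleGraph (Fin n))

theorem coreness_bddAbove (v : Fin n) :
    BddAbove {k : ℕ | ∃ H : G.Subgraph, v ∈ H.verts ∧
      ∀ u ∈ H.verts, k ≤ (H.neighborSet u).ncard} := by
  refine ⟨n, ?_⟩
  rintro k ⟨H, hv, h⟩
  refine (h v hv).trans ?_
  simpa using Set.ncard_le_card (H.neighborSet v)

theorem coreness_le (v : Fin n) : coreness G v ≤ n := by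
  refine csSup_le' ?_
  rintro k ⟨H, hv, h⟩
  refine (h v hv).trans ?_
  simpa using Set.ncard_le_card (H.neighborSet v)

open Classical in
theorem exists_core (v : Fin n) : ∃ S : Finset (Fin n), v ∈ S ∧
    ∀ u ∈ S, coreness G v ≤ (S.filter fun w => G.Adj u w).card := by
  have hmem := Nat.sSup_mem (s := {k : ℕ | ∃ H : G.Subgraph, v ∈ H.verts ∧
      ∀ u ∈ H.verts, k ≤ (H.neighborSet u).ncard})
    ⟨0, G.singletonSubgraph v, by simp, by simp⟩ (coreness_bddAbove G v)
  obtain ⟨H, hv, h⟩ := hmem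
  refine ⟨Finset.univ.filter fun w => w ∈ H.verts, by simpa using hv, fun u hu => ?_⟩
  refine (h u (by simpa using hu)).trans ?_
  rw [← Set.ncard_coe_finset]
  refine Set.ncard_le_ncard (fun w hw => ?_) (Finset.finite_toSet _)
  simp only [Finset.coe_filter, Finset.mem_filter, Finset.mem_univ, true_and, Set.mem_ofPred_eq]
  exact ⟨H.edge_vert (SimpleGraph.Subgraph.Adj.symm hw), H.adj_sub hw⟩

open Classical in
theorem le_coreness {v : Fin n} {S : Finset (Fin n)} {k : ℕ} (hv : v ∈ S)
    (h : ∀ u ∈ S, k ≤ (S.filter fun w => G.Adj u w).card) : k ≤ coreness G v := by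
  refine le_csSup (coreness_bddAbove G v) ⟨(⊤ : G.Subgraph).induce S, by simpa using hv, ?_⟩
  intro u hu
  have hu' : u ∈ S := by simpa using hu
  refine (h u hu').trans ?_
  rw [← Set.ncard_coe_finset]
  refine Set.ncard_le_ncard (fun w hw => ?_) (Set.toFinite _)
  simp only [Finset.coe_filter, Set.mem_ofPred_eq] at hw
  simp [hw, hu']

open Classical in
/-- Vertices of coreness at most `k` are incident to few edges, if only edges that lead to each
other or to vertices of larger coreness are counted. -/
theorem sum_degree_le (k : ℕ) (W : Finset (Fin n)) (hW : ∀ u ∈ W, coreness G u ≤ k) :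
    ∑ u ∈ W, (Finset.univ.filter fun w => G.Adj u w ∧ (w ∈ W ∨ k < coreness G w)).card
      ≤ 2 * k * W.card := by
  induction hc : W.card generalizing W with
  | zero => simp [Finset.card_eq_zero.1 hc]
  | succ m ih =>
    -- If every vertex of `W` had more than `k` such neighbors, then `W` together with all vertices
    -- of coreness above `k` would have minimum degree at least `k + 1`, against `hW`.
    obtain ⟨p, hp, hdeg⟩ : ∃ p ∈ W, (Finset.univ.filter fun w => G.Adj p w ∧
        (w ∈ W ∨ k < coreness G w)).card ≤ k := by
      by_contra! hcon
      obtain ⟨u₀, hu₀⟩ : W.Nonempty := Finset.card_pos.1 (by omega)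
      have : k + 1 ≤ coreness G u₀ := by
        refine le_coreness G (S := Finset.univ.filter fun w => w ∈ W ∨ k < coreness G w)
          (by simp [hu₀]) fun u hu => ?_
        have hu : u ∈ W ∨ k < coreness G u := by simpa using hu
        by_cases huW : u ∈ W
        · refine (hcon u huW).trans_le (Finset.card_le_card fun w => ?_)
          simp
          tauto
        · obtain ⟨S, huS, hS⟩ := exists_core G u
          have hk : k < coreness G u := hu.resolve_left huW
          refine (Nat.succ_le_of_lt hk).trans ((hS u huS).trans (Finset.card_le_card fun w hw => ?_))
          simp only [Finset.mem_filter] at hw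
          have := hk.trans_le (le_coreness G hw.1 hS)
          simp [hw.2, this]
      have := hW u₀ hu₀
      omega
    have hcard : (W.erase p).card = m := by rw [Finset.card_erase_of_mem hp, hc]; rfl
    have hih := ih (W.erase p) (fun u hu => hW u (Finset.mem_of_mem_erase hu)) hcard
    have hsplit : ∀ u ∈ W.erase p,
        (Finset.univ.filter fun w => G.Adj u w ∧ (w ∈ W ∨ k < coreness G w)).card
        ≤ (Finset.univ.filter fun w => G.Adj u w ∧ (w ∈ W.erase p ∨ k < coreness G w)).card
          + if G.Adj p u then 1 else 0 := by
      intro u _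
      have hsub : (Finset.univ.filter fun w => G.Adj u w ∧ (w ∈ W ∨ k < coreness G w))
          ⊆ (Finset.univ.filter fun w => G.Adj u w ∧ (w ∈ W.erase p ∨ k < coreness G w))
            ∪ (if G.Adj p u then {p} else ∅) := by
        intro w hw
        simp only [Finset.mem_filter, Finset.mem_univ, true_and] at hw
        by_cases hwp : w = p
        · subst hwp
          simp [hw.1.symm]
        · refine Finset.mem_union_left _ ?_
          simp [hw.1, hwp, hw.2]
      refine (Finset.card_le_card hsub).trans ((Finset.card_union_le _ _).trans ?_)
      split_ifs <;> simp
    -- Removing `p` costs its own degree and one unit at each neighbor in `W`: at most `k` twice,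
    -- whence `2 * k`.
    have hback : ∑ u ∈ W.erase p, (if G.Adj p u then 1 else 0) ≤ k := by
      rw [← Finset.card_filter]
      refine (Finset.card_le_card fun w hw => ?_).trans hdeg
      simp only [Finset.mem_filter, Finset.mem_erase] at hw
      simp [hw.2, hw.1.2]
    rw [← Finset.add_sum_erase W _ hp]
    have := Finset.sum_le_sum hsplit
    rw [Finset.sum_add_distrib] at this
    have e : 2 * k * (m + 1) = 2 * k * m + 2 * k := by ring
    omega

end Coreness

/-! ### Binary search over thresholds by repeated peeling -/

section Search

variable {n : ℕ}

/-- The threshold tested at stage `s` of `L` by the users whose search index is `b`. -/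
noncomputable def threshold (lam : ℝ) (L s b : ℕ) : ℝ := lam ^ ((2 * b + 1) * 2 ^ (L - s - 1)) / 4

/-- The test of user `v` succeeds in the first `r` rounds of stage `s`, with index `b`. -/
def Passes (lam : ℝ) (L R : ℕ) (est : ℕ → Fin n → ℤ) (s b r : ℕ) (v : Fin n) : Prop :=
  ∀ i < r, threshold lam L s b ≤ est (s * R + i) v

open Classical in
/-- The search index of user `v` after `s` stages, each of which lasts `R` rounds. -/
noncomputable def searchIndex (lam : ℝ) (L R : ℕ) (est : ℕ → Fin n → ℤ) : ℕ → Fin n → ℕ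
  | 0, _ => 0
  | s + 1, v => 2 * searchIndex lam L R est s v +
      if Passes lam L R est s (searchIndex lam L R est s v) R v then 1 else 0

/-- User `v` counts its neighbor `u` in round `r` of stage `s`. -/
def Counts (lam : ℝ) (L R : ℕ) (est : ℕ → Fin n → ℤ) (s r : ℕ) (v u : Fin n) : Prop :=
  searchIndex lam L R est s v < searchIndex lam L R est s u ∨
    searchIndex lam L R est s v = searchIndex lam L R est s u ∧
      Passes lam L R est s (searchIndex lam L R est s u) r u

open Classical in
/-- The number of neighbors that `v` counts in round `r` of stage `s`. -/
noncomputable def activeDegree (lam : ℝ) (L R : ℕ) (est : ℕ → Fin n → ℤ)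
    (N : Set (Fin n)) (s r : ℕ) (v : Fin n) : ℕ :=
  (Finset.univ.filter fun u => u ∈ N ∧ Counts lam L R est s r v u).card

variable {lam : ℝ} {L R : ℕ} {est : ℕ → Fin n → ℤ}

theorem searchIndex_lt (s : ℕ) (v : Fin n) : searchIndex lam L R est s v < 2 ^ s := by
  induction s with
  | zero => simp [searchIndex]
  | succ s ih =>
    rw [searchIndex, pow_succ]
    split_ifs <;> omega

theorem searchIndex_add_div (s i : ℕ) (v : Fin n) :
    searchIndex lam L R est (s + i) v / 2 ^ i = searchIndex lam L R est s v := by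
  induction i with
  | zero => simp
  | succ i ih =>
    rw [← add_assoc, searchIndex, pow_succ', ← Nat.div_div_eq_div_mul, ← ih]
    congr 1
    split_ifs <;> omega

theorem Passes.mono {s b r r' : ℕ} {v : Fin n} (hr : r' ≤ r) (h : Passes lam L R est s b r v) :
    Passes lam L R est s b r' v :=
  fun i hi => h i (hi.trans_le hr)

theorem le_searchIndex_succ (s : ℕ) (v : Fin n) :
    2 * searchIndex lam L R est s v ≤ searchIndex lam L R est (s + 1) v := by
  rw [searchIndex]
  omega

theorem searchIndex_succ_of_passes {s : ℕ} {v : Fin n}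
    (h : Passes lam L R est s (searchIndex lam L R est s v) R v) :
    searchIndex lam L R est (s + 1) v = 2 * searchIndex lam L R est s v + 1 := by
  rw [searchIndex, if_pos h]

theorem searchIndex_succ_of_not_passes {s : ℕ} {v : Fin n}
    (h : ¬ Passes lam L R est s (searchIndex lam L R est s v) R v) :
    searchIndex lam L R est (s + 1) v = 2 * searchIndex lam L R est s v := by
  rw [searchIndex, if_neg h, add_zero]

variable {G : SimpleGraph (Fin n)} {a : ℝ}

/-! ### Correctness of the search when all counts are accurate -/

open Classical in
/-- The members of a dense part of the graph pass all tests of small thresholds. -/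
theorem div_le_searchIndex (hlam : 1 ≤ lam)
    (hest : ∀ s < L, ∀ r < R, ∀ v,
      |(est (s * R + r) v : ℝ) - activeDegree lam L R est (G.neighborSet v) s r v| ≤ a)
    {S : Finset (Fin n)} {k j : ℕ} (hS : ∀ u ∈ S, k ≤ (S.filter fun w => G.Adj u w).card)
    (hj : j < 2 ^ L) (hk : lam ^ j / 4 + a ≤ k) (s : ℕ) (hs : s ≤ L) :
    ∀ u ∈ S, j / 2 ^ (L - s) ≤ searchIndex lam L R est s u := by
  induction s with
  | zero =>
    intro u _
    simp [Nat.div_eq_of_lt hj]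
  | succ s ih =>
    have ih := ih (by omega)
    intro u hu
    have hJ : j / 2 ^ (L - (s + 1)) / 2 = j / 2 ^ (L - s) := by
      rw [Nat.div_div_eq_div_mul, ← pow_succ]
      congr 2
      omega
    have hsub : L - (s + 1) = L - s - 1 := by omega
    set J := j / 2 ^ (L - s) with hJdef
    set J' := j / 2 ^ (L - (s + 1)) with hJ'def
    have h1 := le_searchIndex_succ (lam := lam) (L := L) (R := R) (est := est) s u
    have h2 := ih u hu
    -- A vertex ahead of the prefix `J` of `j` stays ahead whatever its test gives. Otherwise only
    -- an odd `J'` requires the test to succeed.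
    rcases h2.lt_or_eq with h2 | h2
    · omega
    rcases Nat.even_or_odd' J' with ⟨x, hx | hx⟩
    · omega
    have hxJ : x = J := by omega
    have hth : threshold lam L s J ≤ lam ^ j / 4 := by
      unfold threshold
      gcongr ?_ / 4
      refine pow_le_pow_right₀ hlam ?_
      rw [← hsub, ← hxJ, ← hx]
      exact Nat.div_mul_le_self _ _
    -- Induction on rounds, for all such members of `S` at once: the rest of `S` is either ahead or
    -- still alive, so each sees its full degree in `S`.
    have hpass : ∀ r ≤ R, ∀ w ∈ S, searchIndex lam L R est s w = J →
        Passes lam L R est s J r w := by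
      intro r
      induction r with
      | zero => intro _ w _ _ i hi; omega
      | succ r ihr =>
        intro hr w hw hwJ i hi
        rcases Nat.lt_succ_iff_lt_or_eq.1 hi with hi | rfl
        · exact ihr (by omega) w hw hwJ i hi
        have hdeg : k ≤ activeDegree lam L R est (G.neighborSet w) s i w := by
          refine (hS w hw).trans (Finset.card_le_card fun x hx => ?_)
          simp only [Finset.mem_filter] at hx
          simp only [Finset.mem_filter, Finset.mem_univ, true_and, SimpleGraph.mem_neighborSet]
          refine ⟨hx.2, ?_⟩
          rcases (ih x hx.1).lt_or_eq with h | h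
          · exact Or.inl (hwJ.trans_lt h)
          · refine Or.inr ⟨hwJ.trans h, ?_⟩
            rw [← h]
            exact ihr (by omega) x hx.1 h.symm
        have h3 := (abs_le.1 (hest s (by omega) i (by omega) w)).1
        have h4 : (k : ℝ) ≤ activeDegree lam L R est (G.neighborSet w) s i w := by
          exact_mod_cast hdeg
        linarith
    rw [searchIndex_succ_of_passes]
    · omega
    · rw [← h2]
      exact hpass R le_rfl u hu h2.symm

theorem coreness_lt_of_searchIndex (hlam : 1 ≤ lam) (ha : 0 ≤ a)
    (hest : ∀ s < L, ∀ r < R, ∀ v,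
      |(est (s * R + r) v : ℝ) - activeDegree lam L R est (G.neighborSet v) s r v| ≤ a)
    (htop : (n : ℝ) < lam ^ 2 ^ L / 4) (v : Fin n) :
    (coreness G v : ℝ) < lam ^ (searchIndex lam L R est L v + 1) / 4 + a := by
  by_contra! hcon
  by_cases hj : searchIndex lam L R est L v + 1 < 2 ^ L
  · obtain ⟨S, hv, hS⟩ := exists_core G v
    have := div_le_searchIndex hlam hest hS hj hcon L le_rfl v hv
    simp at this
  -- The largest index has no threshold above it to fail, but there the bound already exceeds `n`.
  · have h1 : lam ^ 2 ^ L ≤ lam ^ (searchIndex lam L R est L v + 1) :=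
      pow_le_pow_right₀ hlam (by omega)
    have h2 : (coreness G v : ℝ) ≤ n := by exact_mod_cast coreness_le G v
    linarith

/-- Every exponent is the midpoint of some node of the search tree; its power of two gives the
stage. -/
theorem exists_eq_odd_mul {j : ℕ} (L : ℕ) (hj : 0 < j) (hL : j < 2 ^ L) :
    ∃ s < L, ∃ b, j = (2 * b + 1) * 2 ^ (L - s - 1) := by
  obtain ⟨i, m, hm, rfl⟩ := Nat.exists_eq_two_pow_mul_odd hj.ne'
  obtain ⟨b, rfl⟩ := hm
  have : 2 ^ i < 2 ^ L := lt_of_le_of_lt (Nat.le_mul_of_pos_right _ (by omega)) hL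
  have hi : i < L := (Nat.pow_lt_pow_iff_right (by norm_num)).1 this
  refine ⟨L - i - 1, by omega, b, ?_⟩
  rw [mul_comm]
  congr 2
  omega

open Classical in
/-- Repeated peeling at a threshold well above `2 * k` removes all vertices of coreness `k`. -/
theorem searchIndex_lt_of_coreness_le (hlam : 1 ≤ lam) {γ : ℝ} (hγ : 0 < γ)
    (hest : ∀ s < L, ∀ r < R, ∀ v,
      |(est (s * R + r) v : ℝ) - activeDegree lam L R est (G.neighborSet v) s r v| ≤ a)
    (hR : (n : ℝ) < (1 + γ) ^ R) {k j : ℕ} (hj : 0 < j) (hk : 2 * (1 + γ) * k + a < lam ^ j / 4)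
    (v : Fin n) (hv : coreness G v ≤ k) : searchIndex lam L R est L v < j := by
  -- Downward induction on `j`: larger thresholds also satisfy `hk`, so they are already known to
  -- exceed the final index.
  induction hd : 2 ^ L - j using Nat.strong_induction_on generalizing j v with
  | _ d ih =>
  by_cases hjL : 2 ^ L ≤ j
  · exact (searchIndex_lt L v).trans_le hjL
  push Not at hjL
  have ih' : ∀ j', j < j' → ∀ v, coreness G v ≤ k → searchIndex lam L R est L v < j' := by
    intro j' hj' v hv
    refine ih (2 ^ L - j') (by omega) (by omega) (hk.trans_le ?_) v hv rfl
    gcongr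
  obtain ⟨s, hs, b, hjb⟩ := exists_eq_odd_mul L hj hjL
  -- Being past `b` at stage `s` would force a final index of at least `(b + 1) * 2 ^ (L - s)`,
  -- which exceeds `j`.
  have hbelow : ∀ u, coreness G u ≤ k → searchIndex lam L R est s u ≤ b := by
    intro u hu
    by_contra! hb
    have h1 := ih' ((b + 1) * 2 ^ (L - s)) (by
      rw [hjb, show L - s = (L - s - 1) + 1 by omega, pow_succ]
      have : 0 < 2 ^ (L - s - 1) := by positivity
      simp only [Nat.add_sub_cancel]
      nlinarith) u hu
    have h2 := searchIndex_add_div (lam := lam) (L := L) (R := R) (est := est) s (L - s) u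
    rw [show s + (L - s) = L by omega] at h2
    rw [← Nat.div_lt_iff_lt_mul (by positivity), h2] at h1
    omega
  set W : ℕ → Finset (Fin n) := fun r => Finset.univ.filter fun u =>
    coreness G u ≤ k ∧ searchIndex lam L R est s u = b ∧ Passes lam L R est s b r u with hWdef
  set y := lam ^ j / 4 - a with hy
  have hy0 : 0 < y := by
    have : 0 ≤ 2 * (1 + γ) * (k : ℝ) := by positivity
    linarith
  -- Double counting: each survivor of round `r` has at least `y` counted neighbors, but `W r` has
  -- at most `2 * k` per vertex.
  have hstep : ∀ r < R, (1 + γ) * (W (r + 1)).card ≤ (W r).card := by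
    intro r hr
    have hsub : W (r + 1) ⊆ W r := by
      intro u hu
      simp only [hWdef, Finset.mem_filter, Finset.mem_univ, true_and] at hu ⊢
      exact ⟨hu.1, hu.2.1, hu.2.2.mono (Nat.le_succ r)⟩
    have hlow : ∀ u ∈ W (r + 1), y ≤
        ((Finset.univ.filter fun w => G.Adj u w ∧ (w ∈ W r ∨ k < coreness G w)).card : ℝ) := by
      intro u hu
      simp only [hWdef, Finset.mem_filter, Finset.mem_univ, true_and] at hu
      have h1 := hu.2.2 r (Nat.lt_succ_self r)
      rw [threshold, ← hjb] at h1
      have h2 := (abs_le.1 (hest s hs r hr u)).2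
      have h3 : activeDegree lam L R est (G.neighborSet u) s r u ≤
          (Finset.univ.filter fun w => G.Adj u w ∧ (w ∈ W r ∨ k < coreness G w)).card := by
        refine Finset.card_le_card fun w hw => ?_
        simp only [Finset.mem_filter, Finset.mem_univ, true_and,
          SimpleGraph.mem_neighborSet] at hw ⊢
        refine ⟨hw.1, ?_⟩
        -- By `hbelow`, no vertex of coreness at most `k` is ahead of `b`; so a counted one lies in
        -- `W r`.
        by_cases hwk : k < coreness G w
        · exact Or.inr hwk
        have hwk : coreness G w ≤ k := by omega
        have hwb := hbelow w hwk
        rcases hw.2 with h | ⟨h, hp⟩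
        · omega
        · have e : searchIndex lam L R est s w = b := by omega
          rw [e] at hp
          left
          simp [hWdef, hwk, e, hp]
      have h3 : (activeDegree lam L R est (G.neighborSet u) s r u : ℝ) ≤
          ((Finset.univ.filter fun w => G.Adj u w ∧ (w ∈ W r ∨ k < coreness G w)).card : ℝ) := by
        exact_mod_cast h3
      linarith
    have hsum : (∑ u ∈ W (r + 1), ((Finset.univ.filter fun w => G.Adj u w ∧
        (w ∈ W r ∨ k < coreness G w)).card : ℝ)) ≤ 2 * k * (W r).card := by
      have h1 := sum_degree_le G k (W r) fun u hu => by
        simp only [hWdef, Finset.mem_filter] at hu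
        exact hu.2.1
      have h2 := (Finset.sum_le_sum_of_subset hsub).trans h1
      exact_mod_cast h2
    have hsum' : (W (r + 1)).card * y ≤ 2 * k * (W r).card := by
      refine le_trans ?_ hsum
      rw [← nsmul_eq_mul]
      exact Finset.card_nsmul_le_sum _ _ _ hlow
    refine le_of_mul_le_mul_right ?_ hy0
    calc (1 + γ) * (W (r + 1)).card * y = (1 + γ) * ((W (r + 1)).card * y) := by ring
      _ ≤ (1 + γ) * (2 * k * (W r).card) := by gcongr
      _ = (W r).card * (2 * (1 + γ) * k) := by ring
      _ ≤ (W r).card * y := by gcongr; linarith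
  have hiter : ∀ r ≤ R, (1 + γ) ^ r * (W r).card ≤ n := by
    intro r
    induction r with
    | zero =>
      intro _
      have : (W 0).card ≤ n := by simpa using Finset.card_le_univ (W 0)
      simpa using this
    | succ r ihr =>
      intro hr
      refine le_trans ?_ (ihr (by omega))
      rw [pow_succ, mul_assoc]
      gcongr
      exact hstep r (by omega)
  have hempty : W R = ∅ := by
    by_contra hne
    have h1 : (1 : ℝ) ≤ (W R).card := by
      exact_mod_cast Finset.card_pos.2 (Finset.nonempty_iff_ne_empty.2 hne)
    have h2 := hiter R le_rfl
    have h3 : (1 + γ) ^ R * 1 ≤ (1 + γ) ^ R * ((W R).card : ℝ) := by gcongr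
    linarith
  -- Either `v` was already behind `b`, or it has index `b` and fails because `W R` is empty.
  have hfin : searchIndex lam L R est (s + 1) v ≤ 2 * b := by
    rcases (hbelow v hv).lt_or_eq with h | h
    · have : searchIndex lam L R est (s + 1) v ≤ 2 * searchIndex lam L R est s v + 1 := by
        rw [searchIndex]
        split_ifs <;> omega
      omega
    · rw [searchIndex_succ_of_not_passes, h]
      rw [h]
      intro hp
      have : v ∈ W R := by simp [hWdef, hv, h, hp]
      simp [hempty] at this
  have h2 := searchIndex_add_div (lam := lam) (L := L) (R := R) (est := est) (s + 1) (L - s - 1) v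
  rw [show s + 1 + (L - s - 1) = L by omega] at h2
  rw [hjb, ← Nat.div_lt_iff_lt_mul (by positivity), h2]
  omega

/-- The estimate of the coreness from the final search index. -/
noncomputable def estimate (lam : ℝ) (b : ℕ) : ℝ := if b = 0 then 0 else lam ^ (b + 1) / 4

theorem estimate_bounds (hlam : 1 ≤ lam) (hlam2 : lam ≤ 2) {γ : ℝ} (hγ : 0 < γ) (ha : 0 ≤ a)
    (hest : ∀ s < L, ∀ r < R, ∀ v,
      |(est (s * R + r) v : ℝ) - activeDegree lam L R est (G.neighborSet v) s r v| ≤ a)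
    (htop : (n : ℝ) < lam ^ 2 ^ L / 4) (hR : (n : ℝ) < (1 + γ) ^ R) (v : Fin n) :
    (coreness G v : ℝ) - 2 * a ≤ estimate lam (searchIndex lam L R est L v) ∧
      estimate lam (searchIndex lam L R est L v)
        ≤ lam * (2 * (1 + γ)) * coreness G v + 2 * a := by
  have hlow := coreness_lt_of_searchIndex hlam ha hest htop v
  unfold estimate
  split_ifs with h
  · rw [h, zero_add, pow_one] at hlow
    refine ⟨?_, by positivity⟩
    -- The divisor `4` matters here: `lam / 4 ≤ 1 / 2`, so positive coreness forces `a > 1 / 2`, and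
    -- the estimate `0` is within `2 * a`.
    rcases Nat.eq_zero_or_pos (coreness G v) with h0 | h0
    · rw [h0]
      push_cast
      linarith
    · have : (1 : ℝ) ≤ coreness G v := by exact_mod_cast h0
      linarith
  · refine ⟨by linarith, ?_⟩
    by_contra! hcon
    refine lt_irrefl _ (searchIndex_lt_of_coreness_le hlam hγ hest hR (Nat.pos_of_ne_zero h)
      (k := coreness G v) ?_ v le_rfl)
    have h0 : 0 < lam := by linarith
    have : lam * (2 * (1 + γ) * coreness G v + a)
        < lam * (lam ^ searchIndex lam L R est L v / 4) := by
      have e : lam * (lam ^ searchIndex lam L R est L v / 4)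
          = lam ^ (searchIndex lam L R est L v + 1) / 4 := by ring
      rw [e]
      nlinarith
    exact lt_of_mul_lt_mul_left this h0.le

end Search

/-! ### Sums along a two-level chain of increments -/

/-- The index from which increment `m` leads to index `m + 1`: blocks have length `l + 1`, and at
the end of a block the increment is that of the whole block. -/
def prevIndex (l m : ℕ) : ℕ := if l + 1 ∣ m + 1 then m - l else m

theorem prevIndex_le (l m : ℕ) : prevIndex l m ≤ m := by
  unfold prevIndex
  split_ifs <;> omega

/-- The increments that lead from index `0` to index `m`. -/
def chain (l : ℕ) : ℕ → Finset ℕ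
  | 0 => ∅
  | m + 1 => insert m (chain l (prevIndex l m))
decreasing_by exact Nat.lt_succ_of_le (prevIndex_le l m)

theorem chain_zero (l : ℕ) : chain l 0 = ∅ := by rw [chain]

theorem chain_succ (l m : ℕ) : chain l (m + 1) = insert m (chain l (prevIndex l m)) := by
  rw [chain]

theorem lt_of_mem_chain {l m i : ℕ} (h : i ∈ chain l m) : i < m := by
  induction m using Nat.strong_induction_on with
  | _ m ih =>
    cases m with
    | zero => simp [chain_zero] at h
    | succ m =>
      rw [chain_succ, Finset.mem_insert] at h
      have hp := prevIndex_le l m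
      rcases h with rfl | h
      · omega
      · have := ih _ (by omega) h
        omega

theorem sum_chain_succ (l m : ℕ) (y : ℕ → ℤ) :
    ∑ i ∈ chain l (m + 1), y i = y m + ∑ i ∈ chain l (prevIndex l m), y i := by
  rw [chain_succ, Finset.sum_insert]
  intro h
  have := lt_of_mem_chain h
  have := prevIndex_le l m
  omega

theorem sum_chain_sub (l m : ℕ) (X : ℕ → ℤ) :
    ∑ i ∈ chain l m, (X (i + 1) - X (prevIndex l i)) = X m - X 0 := by
  induction m using Nat.strong_induction_on with
  | _ m ih =>
    cases m with
    | zero => simp [chain_zero]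
    | succ m =>
      rw [sum_chain_succ, ih _ (Nat.lt_succ_of_le (prevIndex_le l m))]
      ring

theorem card_chain_le (l m : ℕ) : (chain l m).card ≤ m / (l + 1) + m % (l + 1) := by
  induction m using Nat.strong_induction_on with
  | _ m ih =>
    cases m with
    | zero => simp [chain_zero]
    | succ m =>
      rw [chain_succ]
      refine (Finset.card_insert_le _ _).trans ?_
      have := ih _ (Nat.lt_succ_of_le (prevIndex_le l m))
      unfold prevIndex at this ⊢
      split_ifs at this ⊢ with h
      · obtain ⟨k, hk⟩ := h
        cases k with
        | zero => simp at hk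
        | succ k =>
          have e : m - l = (l + 1) * k := by rw [Nat.mul_succ] at hk; omega
          rw [e] at this ⊢
          rw [hk]
          simp only [Nat.mul_mod_right, Nat.mul_div_cancel_left _ (Nat.succ_pos l)] at this ⊢
          omega
      · have h1 := Nat.succ_div_of_not_dvd h
        have h2 := Nat.div_add_mod m (l + 1)
        have h3 := Nat.div_add_mod (m + 1) (l + 1)
        rw [h1] at h3 ⊢
        omega

/-- The increments along the chain have at most twice the total variation. -/
theorem sum_abs_sub_prevIndex_le (l t : ℕ) (X : ℕ → ℤ) :
    ∑ i ∈ Finset.range t, |X (i + 1) - X (prevIndex l i)|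
      ≤ 2 * ∑ i ∈ Finset.range t, |X (i + 1) - X i| := by
  -- The added term is the drift since the start of the current block; it pays for the long
  -- increment at the end of the block.
  suffices h : ∑ i ∈ Finset.range t, |X (i + 1) - X (prevIndex l i)|
      + |X t - X ((l + 1) * (t / (l + 1)))| ≤ 2 * ∑ i ∈ Finset.range t, |X (i + 1) - X i| by
    linarith [abs_nonneg (X t - X ((l + 1) * (t / (l + 1))))]
  induction t with
  | zero => simp
  | succ t ih =>
    rw [Finset.sum_range_succ, Finset.sum_range_succ]
    have h1 := abs_sub_le (X (t + 1)) (X t) (X ((l + 1) * (t / (l + 1))))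
    by_cases h : l + 1 ∣ t + 1
    · have e : prevIndex l t = (l + 1) * (t / (l + 1)) := by
        rw [prevIndex, if_pos h]
        have h2 := Nat.succ_div_of_dvd h
        have h3 := Nat.mul_div_cancel' h
        rw [h2, Nat.mul_succ] at h3
        omega
      rw [Nat.mul_div_cancel' h, e, sub_self, abs_zero]
      linarith [abs_nonneg (X (t + 1) - X t)]
    · rw [Nat.succ_div_of_not_dvd h, prevIndex, if_neg h]
      linarith

/-- An indicator that increases only at multiples of `R` has small total variation. -/
theorem sum_abs_sub_le (L R : ℕ) (X : ℕ → ℤ) (h0 : ∀ i, 0 ≤ X i)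
    (h1 : ∀ i, X i ≤ 1) (hX : X 0 = 0) (hR : ∀ i, ¬ R ∣ i → X (i + 1) ≤ X i) :
    ∑ i ∈ Finset.range (L * R), |X (i + 1) - X i| ≤ 2 * L := by
  -- `X t` serves as a potential: each drop is paid for by an earlier rise, and rises occur only at
  -- multiples of `R`.
  have key : ∀ t, ∑ i ∈ Finset.range t, |X (i + 1) - X i| + X t
      ≤ 2 * ∑ i ∈ Finset.range t, if R ∣ i then (1 : ℤ) else 0 := by
    intro t
    induction t with
    | zero => simp [hX]
    | succ t ih =>
      rw [Finset.sum_range_succ, Finset.sum_range_succ]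
      split_ifs with h
      · have : |X (t + 1) - X t| ≤ 2 - X (t + 1) + X t := by
          rw [abs_le]
          constructor <;> linarith [h0 t, h1 t, h0 (t + 1), h1 (t + 1)]
        linarith
      · rw [abs_of_nonpos (by linarith [hR t h])]
        linarith
  have hcount : (∑ i ∈ Finset.range (L * R), if R ∣ i then (1 : ℤ) else 0) ≤ L := by
    rw [Finset.sum_boole]
    have hsub : ((Finset.range (L * R)).filter fun i => R ∣ i)
        ⊆ (Finset.range L).image fun k => R * k := by
      intro i hi
      simp only [Finset.mem_filter, Finset.mem_range, Finset.mem_image] at hi ⊢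
      obtain ⟨h, k, rfl⟩ := hi
      exact ⟨k, by rw [mul_comm] at h; exact lt_of_mul_lt_mul_right' h, rfl⟩
    have := (Finset.card_le_card hsub).trans Finset.card_image_le
    rw [Finset.card_range] at this
    exact_mod_cast this
  linarith [key (L * R), h0 (L * R)]

/-! ### The mechanism -/

section

variable {n : ℕ} (l : ℕ) (lam : ℝ) (L R : ℕ)

/-- The noisy counts reconstructed from the answers. -/
def noisyCounts (y : ℕ → Fin n → ℤ) (i : ℕ) (v : Fin n) : ℤ := ∑ m ∈ chain l (i + 1), y m v

open Classical in
/-- Whether `v` counts `u` in round `i - 1`; nothing is counted at index `0`. -/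
noncomputable def countIndicator (y : ℕ → Fin n → ℤ) (v u : Fin n) : ℕ → ℤ
  | 0 => 0
  | i + 1 => if Counts lam L R (noisyCounts l y) (i / R) (i % R) v u then 1 else 0

open Classical in
/-- In round `t`, user `v` reports the increment of its count along the chain. -/
noncomputable def searchQueries : Queries n := fun y t v N =>
  -- Vanishing queries after the last round bound the sensitivity on transcripts of every length,
  -- reachable or not.
  if t < L * R then ∑ u, if u ∈ N then
    countIndicator l lam L R y v u (t + 1) - countIndicator l lam L R y v u (prevIndex l t) else 0
  else 0

/-! ### Causality of the queries -/

variable {L R lam} in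
theorem searchIndex_congr {est est' : ℕ → Fin n → ℤ} (s : ℕ)
    (h : ∀ i < s * R, est i = est' i) (v : Fin n) :
    searchIndex lam L R est s v = searchIndex lam L R est' s v := by
  induction s with
  | zero => rfl
  | succ s ih =>
    rw [Nat.succ_mul] at h
    have ih := ih fun i hi => h i (by omega)
    have hp : Passes lam L R est s (searchIndex lam L R est' s v) R v ↔
        Passes lam L R est' s (searchIndex lam L R est' s v) R v := by
      unfold Passes
      refine forall₂_congr fun i hi => ?_
      rw [h _ (by omega)]
    classical
    rw [searchIndex, searchIndex, ih, if_congr hp rfl rfl]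

variable {L R lam} in
theorem counts_congr {est est' : ℕ → Fin n → ℤ} (s r : ℕ)
    (h : ∀ i < s * R + r, est i = est' i) (v u : Fin n) :
    Counts lam L R est s r v u ↔ Counts lam L R est' s r v u := by
  have e := searchIndex_congr (lam := lam) (L := L) (R := R) s fun i hi => h i (by omega)
  have hp : Passes lam L R est s (searchIndex lam L R est' s u) r u ↔
      Passes lam L R est' s (searchIndex lam L R est' s u) r u := by
    unfold Passes
    refine forall₂_congr fun i hi => ?_
    rw [h _ (by omega)]
  simp only [Counts, e, hp]

theorem countIndicator_congr {y y' : ℕ → Fin n → ℤ} {t i : ℕ} (h : ∀ j < t, y j = y' j)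
    (hi : i ≤ t + 1) (v u : Fin n) :
    countIndicator l lam L R y v u i = countIndicator l lam L R y' v u i := by
  cases i with
  | zero => rfl
  | succ i =>
    have : ∀ j < i / R * R + i % R, noisyCounts l y j = noisyCounts l y' j := by
      intro j hj
      rw [Nat.div_add_mod'] at hj
      funext w
      refine Finset.sum_congr rfl fun m hm => ?_
      have := lt_of_mem_chain hm
      rw [h m (by omega)]
    classical
    exact if_congr (counts_congr _ _ this v u) rfl rfl

theorem searchQueries_isCausal : (searchQueries l lam L R : Queries n).IsCausal := by
  intro y y' t h
  funext v N
  have hp := prevIndex_le l t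
  unfold searchQueries
  split_ifs with ht
  · refine Finset.sum_congr rfl fun u _ => ?_
    rw [countIndicator_congr l lam L R h le_rfl,
      countIndicator_congr l lam L R h (i := prevIndex l t) (by omega)]
  · rfl

/-! ### Sensitivity of the queries -/

theorem sum_abs_countIndicator_le (y : ℕ → Fin n → ℤ) (v u : Fin n) :
    ∑ i ∈ Finset.range (L * R), |countIndicator l lam L R y v u (i + 1)
      - countIndicator l lam L R y v u (prevIndex l i)| ≤ 4 * L := by
  have h := sum_abs_sub_le L R (countIndicator l lam L R y v u) (fun i => ?_) (fun i => ?_) rfl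
    (fun i hi => ?_)
  · linarith [sum_abs_sub_prevIndex_le l (L * R) (countIndicator l lam L R y v u)]
  · cases i with
    | zero => exact le_rfl
    | succ i => simp only [countIndicator]; split_ifs <;> norm_num
  · cases i with
    | zero => exact zero_le_one
    | succ i => simp only [countIndicator]; split_ifs <;> norm_num
  -- Index `i + 1` belongs to round `i`. Away from stage boundaries the search indices are fixed and
  -- passing is monotone, so nobody starts to be counted.
  · cases i with
    | zero => simp at hi
    | succ i =>
      have h1 := Nat.succ_div_of_not_dvd hi
      have h2 := Nat.div_add_mod i R
      have h3 := Nat.div_add_mod (i + 1) R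
      rw [h1] at h3
      have h4 : (i + 1) % R = i % R + 1 := by omega
      have hc : Counts lam L R (noisyCounts l y) ((i + 1) / R) ((i + 1) % R) v u →
          Counts lam L R (noisyCounts l y) (i / R) (i % R) v u := by
        rw [h1, h4]
        rintro (h | ⟨h, hp⟩)
        · exact Or.inl h
        · exact Or.inr ⟨h, hp.mono (Nat.le_succ _)⟩
      simp only [countIndicator]
      split_ifs with h5 h6
      · exact le_rfl
      · exact absurd (hc h5) h6
      · norm_num
      · exact le_rfl

open Classical in
theorem card_symmDiff_pairs_le {G G' : SimpleGraph (Fin n)} (h : EdgeNeighboring G G') :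
    ((Finset.univ : Finset (Fin n × Fin n)).filter
      fun p => s(p.1, p.2) ∈ symmDiff G.edgeSet G'.edgeSet).card ≤ 2 := by
  rcases Set.encard_le_one_iff_eq.1 h with h | ⟨e, h⟩
  · simp [h]
  · induction e using Sym2.ind with
    | _ x y =>
      refine (Finset.card_le_card (t := {(x, y), (y, x)}) ?_).trans Finset.card_le_two
      rintro ⟨a, b⟩ hab
      simpa [h] using hab

-- An edge is seen by both endpoints, giving two ordered pairs, each with variation at most `4 * L`
-- along the chain.
open Classical in
theorem sensitivity_searchQueries_le {G G' : SimpleGraph (Fin n)}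
    (h : EdgeNeighboring G G') (τ : Transcript n) :
    sensitivity (searchQueries l lam L R) G.neighborSet G'.neighborSet τ ≤ 8 * L := by
  set y := answers τ
  set E := (Finset.univ : Finset (Fin n × Fin n)).filter
      fun p => s(p.1, p.2) ∈ symmDiff G.edgeSet G'.edgeSet
  set D : ℕ → Fin n × Fin n → ℤ := fun i p => |countIndicator l lam L R y p.1 p.2 (i + 1)
      - countIndicator l lam L R y p.1 p.2 (prevIndex l i)|
  have hround : ∀ i, ∑ v, |searchQueries l lam L R y i v (G.neighborSet v)
      - searchQueries l lam L R y i v (G'.neighborSet v)|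
      ≤ if i < L * R then ∑ p ∈ E, D i p else 0 := by
    intro i
    unfold searchQueries
    split_ifs with hi
    · rw [Finset.sum_filter, Fintype.sum_prod_type]
      refine Finset.sum_le_sum fun v _ => ?_
      rw [← Finset.sum_sub_distrib]
      refine (Finset.abs_sum_le_sum_abs _ _).trans (Finset.sum_le_sum fun u _ => ?_)
      simp only [SimpleGraph.mem_neighborSet, Set.mem_symmDiff, SimpleGraph.mem_edgeSet]
      by_cases h1 : G.Adj v u <;> by_cases h2 : G'.Adj v u <;> simp [h1, h2, D, abs_sub_comm]
    · simp
  have hall : ((sensitivity (searchQueries l lam L R) G.neighborSet G'.neighborSet τ : ℕ) : ℤ)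
      ≤ ∑ i ∈ Finset.range (L * R), ∑ p ∈ E, D i p := by
    unfold sensitivity
    push_cast
    have hnn : ∀ i, 0 ≤ ∑ p ∈ E, D i p := fun i => Finset.sum_nonneg fun p _ => abs_nonneg _
    calc _ ≤ ∑ i ∈ Finset.range τ.length, if i < L * R then ∑ p ∈ E, D i p else 0 :=
          Finset.sum_le_sum fun i _ => hround i
      _ = ∑ i ∈ (Finset.range τ.length).filter (· < L * R), ∑ p ∈ E, D i p :=
          (Finset.sum_filter _ _).symm
      _ ≤ _ := Finset.sum_le_sum_of_subset_of_nonneg (fun i hi => by simp at hi ⊢; exact hi.2)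
          fun i _ _ => hnn i
  rw [Finset.sum_comm] at hall
  have hE : ∑ p ∈ E, ∑ i ∈ Finset.range (L * R), D i p ≤ E.card * (4 * L : ℤ) := by
    rw [← nsmul_eq_mul]
    exact Finset.sum_le_card_nsmul _ _ _ fun p _ =>
      sum_abs_countIndicator_le l lam L R y p.1 p.2
  have hcard : (E.card : ℤ) ≤ 2 := by exact_mod_cast card_symmDiff_pairs_le h
  have : (E.card : ℤ) * (4 * L : ℤ) ≤ 2 * (4 * L : ℤ) := by gcongr
  zify
  linarith

/-- True increments telescope along the chain, so the error of a count is exactly the sum of the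
noises on its chain. -/
theorem noisyCounts_sub_activeDegree (y : ℕ → Fin n → ℤ) (v : Fin n) (N : Set (Fin n)) {t : ℕ}
    (ht : t < L * R) :
    noisyCounts l y t v - activeDegree lam L R (noisyCounts l y) N (t / R) (t % R) v
      = ∑ i ∈ chain l (t + 1), (y i v - searchQueries l lam L R y i v N) := by
  classical
  have hq : ∑ i ∈ chain l (t + 1), searchQueries l lam L R y i v N
      = activeDegree lam L R (noisyCounts l y) N (t / R) (t % R) v := by
    have h1 : ∀ i ∈ chain l (t + 1), searchQueries l lam L R y i v N
        = (∑ u, if u ∈ N then countIndicator l lam L R y v u (i + 1) else 0)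
          - ∑ u, if u ∈ N then countIndicator l lam L R y v u (prevIndex l i) else 0 := by
      intro i hi
      have := lt_of_mem_chain hi
      rw [searchQueries, if_pos (by omega), ← Finset.sum_sub_distrib]
      refine Finset.sum_congr rfl fun u _ => ?_
      split_ifs <;> simp
    rw [Finset.sum_congr rfl h1, sum_chain_sub l (t + 1) fun i =>
      ∑ u, if u ∈ N then countIndicator l lam L R y v u i else 0]
    simp only [countIndicator, ite_self, Finset.sum_const_zero, sub_zero, activeDegree,
      ← ite_and, Finset.sum_boole]
  rw [Finset.sum_sub_distrib, hq]
  rfl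

end

/-- The mechanism that searches for the coreness of all vertices, with noise parameter `β`. -/
noncomputable def searchMechanism (n l : ℕ) (lam : ℝ) (L R : ℕ) (β : ℝ) (hβ : 0 < β) :
    LocalMechanism n :=
  noisyQueries (L * R)
    (discreteLaplace (Real.exp (-β)) (Real.exp_pos _) (Real.exp_lt_one_iff.2 (neg_neg_of_pos hβ)))
    (searchQueries l lam L R)
    fun τ v => estimate lam (searchIndex lam L R (noisyCounts l (answers τ)) L v)

theorem searchMechanism_isEdgeDP (n l : ℕ) (lam : ℝ) (L R : ℕ) (β : ℝ) (hβ : 0 < β) :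
    (searchMechanism n l lam L R β hβ).IsEdgeDP (16 * L * β) := by
  have e : ((Real.exp (-β)) ^ 2)⁻¹ = Real.exp (2 * β) := by
    rw [← Real.exp_nat_mul, ← Real.exp_neg]
    congr 1
    push_cast
    ring
  refine noisyQueries_isEdgeDP _ _ (ρ := ENNReal.ofReal (Real.exp (2 * β))) (Δ := 8 * L) ?_ ?_
    (fun z w => ?_) (searchQueries_isCausal l lam L R)
    fun G G' h τ => sensitivity_searchQueries_le l lam L R h τ
  · rw [ENNReal.one_le_ofReal]
    exact Real.one_le_exp (by positivity)
  · rw [← ENNReal.ofReal_pow (Real.exp_pos _).le, ← Real.exp_nat_mul]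
    apply le_of_eq
    congr 2
    push_cast
    ring
  · rw [← ENNReal.ofReal_pow (Real.exp_pos _).le, ← e]
    exact discreteLaplace_apply_le_mul _ _ _ z w

/-- Chernoff's bound before taking expectations: the right-hand side is at least `1` whenever the
noise on `D` is large. -/
theorem one_le_mul_prod_noise {β a : ℝ} {m : ℕ} (hβ : 0 < β) (D : Finset ℕ) (hD : D.card ≤ m)
    (z : ℕ → ℤ) (hz : a < ∑ i ∈ D, |(z i : ℝ)|) :
    1 ≤ ENNReal.ofReal (2 ^ m * Real.exp (-(β * a))) *
      ∏ i ∈ D, ENNReal.ofReal ((Real.exp (-β))⁻¹ ^ (z i).natAbs / 2) := by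
  rw [← ENNReal.ofReal_prod_of_nonneg fun i _ => by positivity,
    ← ENNReal.ofReal_mul (by positivity), ENNReal.one_le_ofReal, Finset.prod_div_distrib,
    Finset.prod_const, Finset.prod_pow_eq_pow_sum, ← Real.exp_neg, neg_neg, ← Real.exp_nat_mul]
  have h1 : (((∑ i ∈ D, (z i).natAbs : ℕ)) : ℝ) = ∑ i ∈ D, |(z i : ℝ)| := by
    push_cast
    simp [Nat.cast_natAbs]
  rw [h1]
  have h2 : (2 : ℝ) ^ D.card ≤ 2 ^ m := pow_le_pow_right₀ (by norm_num) hD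
  have h3 : 1 ≤ Real.exp (-(β * a)) * Real.exp ((∑ i ∈ D, |(z i : ℝ)|) * β) := by
    rw [← Real.exp_add]
    refine Real.one_le_exp ?_
    nlinarith
  have h4 : 2 ^ m * Real.exp (-(β * a)) * (Real.exp ((∑ i ∈ D, |(z i : ℝ)|) * β) / 2 ^ D.card)
      = 2 ^ m / 2 ^ D.card *
        (Real.exp (-(β * a)) * Real.exp ((∑ i ∈ D, |(z i : ℝ)|) * β)) := by ring
  rw [h4]
  exact one_le_mul_of_one_le_of_one_le ((one_le_div (by positivity)).2 h2) h3

theorem searchMechanism_accurate {n l : ℕ} {lam : ℝ} {L R : ℕ} (hL : 0 < L) (hR : 0 < R) {β : ℝ}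
    (hβ : 0 < β) (hlam : 1 ≤ lam) (hlam2 : lam ≤ 2) {γ a : ℝ} (hγ : 0 < γ) (ha : 0 ≤ a)
    (htop : (n : ℝ) < lam ^ 2 ^ L / 4) (hn : (n : ℝ) < (1 + γ) ^ R) {m : ℕ}
    (hm : ∀ t < L * R, (chain l (t + 1)).card ≤ m) (G : SimpleGraph (Fin n)) :
    ENNReal.ofReal (1 - n * (L * R) * (2 ^ m * Real.exp (-(β * a)))) ≤
      ((searchMechanism n l lam L R β hβ).transcriptLaw G (L * R)).toOuterMeasure
        {τ | ∀ v : Fin n,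
          (coreness G v : ℝ) - 2 * a ≤ (searchMechanism n l lam L R β hβ).output τ v ∧
          (searchMechanism n l lam L R β hβ).output τ v
            ≤ lam * (2 * (1 + γ)) * coreness G v + 2 * a} := by
  set P := (searchMechanism n l lam L R β hβ).transcriptLaw G (L * R)
  set κ := 2 ^ m * Real.exp (-(β * a))
  set h : ℤ → ℝ≥0∞ := fun z => ENNReal.ofReal ((Real.exp (-β))⁻¹ ^ z.natAbs / 2)
  set Φ : Fin n → ℕ → Transcript n → ℝ≥0∞ := fun v t τ =>
    ∏ i ∈ chain l (t + 1) with i < τ.length,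
      h (answers τ i v - searchQueries l lam L R (answers τ) i v (G.neighborSet v))
  have hΦ : ∀ v t, ∑' τ, P τ * Φ v t τ ≤ 1 := fun v t =>
    tsum_noisyQueries_prod_le (L * R) _ (tsum_discreteLaplace_mul_le _ _ _)
      (searchQueries_isCausal l lam L R) G v (chain l (t + 1)) (L * R)
  -- A union bound over users and rounds: if some count errs by more than `a`, a single summand
  -- already makes `F` at least `1`.
  set F : Transcript n → ℝ≥0∞ := fun τ =>
    ENNReal.ofReal κ * ∑ v, ∑ t ∈ Finset.range (L * R), Φ v t τ
  have hF : ∑' τ, P τ * F τ ≤ ENNReal.ofReal (n * (L * R) * κ) := by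
    have e : ∀ τ, P τ * F τ
        = ENNReal.ofReal κ * ∑ v, ∑ t ∈ Finset.range (L * R), P τ * Φ v t τ := by
      intro τ
      simp only [F, mul_left_comm (P τ), Finset.mul_sum]
    simp_rw [e]
    rw [ENNReal.tsum_mul_left, Summable.tsum_finsetSum fun _ _ => ENNReal.summable]
    have e2 : ∀ v, ∑' τ, ∑ t ∈ Finset.range (L * R), P τ * Φ v t τ
        ≤ ((L * R : ℕ) : ℝ≥0∞) := by
      intro v
      rw [Summable.tsum_finsetSum fun _ _ => ENNReal.summable]
      refine (Finset.sum_le_card_nsmul _ _ 1 fun t _ => hΦ v t).trans ?_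
      simp
    calc _ ≤ ENNReal.ofReal κ * ((Finset.univ : Finset (Fin n)).card • ((L * R : ℕ) : ℝ≥0∞)) := by
          gcongr
          exact Finset.sum_le_card_nsmul _ _ _ fun v _ => e2 v
      _ = ENNReal.ofReal (n * (L * R) * κ) := by
          rw [Finset.card_univ, Fintype.card_fin, nsmul_eq_mul, ← Nat.cast_mul,
            ← ENNReal.ofReal_natCast, ← ENNReal.ofReal_mul (by positivity)]
          congr 1
          push_cast
          ring
  rw [ENNReal.ofReal_sub _ (by positivity), ENNReal.ofReal_one]
  refine one_sub_le_toOuterMeasure P _ F _ hF fun τ hτ hbad => ?_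
  have hlen := (noisyQueries_support _ _ _ _ (Nat.mul_pos hL hR) G _ le_rfl τ hτ).1
  by_contra hsmall
  refine hbad ?_
  refine estimate_bounds hlam hlam2 hγ ha (fun s hs r hr v => ?_) htop hn
  by_contra hlarge
  push Not at hlarge
  refine hsmall ?_
  have ht : s * R + r < L * R := by
    have : (s + 1) * R ≤ L * R := Nat.mul_le_mul_right R hs
    rw [Nat.succ_mul] at this
    omega
  have hdiv : (s * R + r) / R = s := by
    rw [mul_comm, Nat.mul_add_div hR, Nat.div_eq_of_lt hr, add_zero]
  have hmod : (s * R + r) % R = r := by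
    rw [mul_comm, Nat.mul_add_mod, Nat.mod_eq_of_lt hr]
  have hsum := noisyCounts_sub_activeDegree l lam L R (answers τ) v (G.neighborSet v) ht
  rw [hdiv, hmod] at hsum
  have hsum' := congrArg (Int.cast : ℤ → ℝ) hsum
  push_cast at hsum'
  have hfilter : ((chain l (s * R + r + 1)).filter fun i => i < τ.length)
      = chain l (s * R + r + 1) :=
    Finset.filter_true_of_mem fun i hi => by
      have := lt_of_mem_chain hi
      omega
  have hone := one_le_mul_prod_noise hβ (chain l (s * R + r + 1)) (hm _ ht)
    (fun i => answers τ i v - searchQueries l lam L R (answers τ) i v (G.neighborSet v))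
    (a := a) (by
      refine hlarge.trans_le ?_
      rw [hsum']
      push_cast
      exact Finset.abs_sum_le_sum_abs _ _)
  refine hone.trans ?_
  have hle : Φ v (s * R + r) τ ≤ ∑ v, ∑ t ∈ Finset.range (L * R), Φ v t τ :=
    (Finset.single_le_sum (f := fun t => Φ v t τ) (fun _ _ => zero_le)
      (Finset.mem_range.2 ht)).trans
      (Finset.single_le_sum (f := fun v => ∑ t ∈ Finset.range (L * R), Φ v t τ)
        (fun _ _ => zero_le) (Finset.mem_univ v))
  refine le_trans (le_of_eq ?_) (mul_le_mul_right hle _)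
  simp only [Φ, hfilter]
  rfl

open Filter Real

/-! ### Choice of the parameters -/

theorem eventually_log_le {μ : ℝ} (hμ : 0 < μ) : ∀ᶠ x : ℝ in atTop, log x ≤ μ * x := by
  filter_upwards [isLittleO_log_id_atTop.bound hμ, eventually_ge_atTop 1] with x hx h1
  have h2 : log x ≤ ‖log x‖ := le_norm_self _
  simp only [id_eq, norm_of_nonneg (zero_le_one.trans h1)] at hx
  exact h2.trans hx

/-- Numbers of stages and of rounds that suffice for `x = log n`. -/
theorem eventually_parameters {κ lam γ : ℝ} (hκ : 0 < κ) (hlam : 1 < lam) (hγ : 0 < γ) :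
    ∀ᶠ x : ℝ in atTop, 1 ≤ x ∧ ∃ L R : ℕ, 0 < L ∧ 0 < R ∧
      exp x < lam ^ 2 ^ L / 4 ∧ exp x < (1 + γ) ^ R ∧
      (L * R : ℝ) ≤ x / κ * x ∧ (L * R : ℝ) ≤ x ^ 2 ∧ (L : ℝ) ≤ 8 * log (x / κ) := by
  set K := 2 / log (1 + γ) with hK
  have hlγ : 0 < log (1 + γ) := log_pos (by linarith)
  have hll : 0 < log lam := log_pos hlam
  have hK0 : 0 < K := by positivity
  -- `L * R` is of order `x * log x`, hence eventually below any multiple of `x ^ 2`; `μ` is chosen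
  -- to give both required bounds.
  set μ := min 1 (1 / κ) with hμdef
  have hμ : 0 < μ := by positivity
  filter_upwards [eventually_log_le (show 0 < μ / (4 * (K + 1)) by positivity),
    eventually_ge_atTop 1, tendsto_log_atTop.eventually_ge_atTop 1,
    tendsto_log_atTop.eventually_ge_atTop (2 * log κ),
    eventually_ge_atTop (3 / log lam)] with x hx1 hx2 hx3 hx4 hx5
  have hx0 : 0 < x := by linarith
  -- The factor `3` works because `3 * log 2 > 2`, which gives `2 ^ L ≥ x ^ 2` thresholds.
  set L := ⌈3 * log x⌉₊ with hLdef
  set R := ⌈K * x⌉₊ with hRdef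
  have hL1 : 3 * log x ≤ L := Nat.le_ceil _
  have hL2 : (L : ℝ) ≤ 4 * log x := by
    have := Nat.ceil_lt_add_one (show 0 ≤ 3 * log x by linarith)
    linarith
  have hR1 : K * x ≤ R := Nat.le_ceil _
  have hR2 : (R : ℝ) ≤ (K + 1) * x := by
    have := Nat.ceil_lt_add_one (show 0 ≤ K * x by positivity)
    linarith
  have hLR : (L * R : ℝ) ≤ μ * x ^ 2 := by
    calc (L * R : ℝ) ≤ (4 * log x) * ((K + 1) * x) := by gcongr
      _ ≤ (4 * (μ / (4 * (K + 1)) * x)) * ((K + 1) * x) := by gcongr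
      _ = μ * x ^ 2 := by field_simp
  refine ⟨hx2, L, R, Nat.ceil_pos.2 (by linarith), Nat.ceil_pos.2 (by positivity), ?_, ?_, ?_, ?_,
    ?_⟩
  · have h2L : x ^ 2 ≤ (2 : ℝ) ^ L := by
      have e1 : (2 : ℝ) ^ L = exp (L * log 2) := by
        rw [exp_nat_mul, exp_log (by norm_num)]
      have e2 : x ^ 2 = exp (2 * log x) := by
        have := exp_nat_mul (log x) 2
        rw [exp_log hx0] at this
        exact_mod_cast this.symm
      rw [e1, e2]
      refine exp_le_exp.2 ?_
      have := log_two_gt_d9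
      nlinarith
    have e : lam ^ 2 ^ L = exp ((2 : ℝ) ^ L * log lam) := by
      rw [← exp_log (show 0 < lam by linarith), ← exp_nat_mul, log_exp]
      push_cast
      rfl
    have h4 : (4 : ℝ) = exp (log 4) := (exp_log (by norm_num)).symm
    have hlog4 : log 4 < 2 := by
      rw [show (4 : ℝ) = 2 ^ 2 by norm_num, log_pow]
      have := log_two_lt_d9
      push_cast
      linarith
    rw [lt_div_iff₀ (by norm_num), e]
    conv_lhs => rw [h4]
    rw [← exp_add]
    refine exp_lt_exp.2 ?_
    rw [div_le_iff₀ hll] at hx5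
    have : x ^ 2 * log lam ≤ 2 ^ L * log lam := by gcongr
    nlinarith
  · rw [← exp_log (show 0 < 1 + γ by linarith), ← exp_nat_mul]
    refine exp_lt_exp.2 ?_
    have : K * x * log (1 + γ) ≤ R * log (1 + γ) := by gcongr
    have e : K * x * log (1 + γ) = 2 * x := by rw [hK]; field_simp
    linarith
  · refine hLR.trans ?_
    calc μ * x ^ 2 ≤ 1 / κ * x ^ 2 := by gcongr; exact min_le_right _ _
      _ = x / κ * x := by ring
  · refine hLR.trans ?_
    calc μ * x ^ 2 ≤ 1 * x ^ 2 := by gcongr; exact min_le_left _ _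
      _ = x ^ 2 := one_mul _
  · rw [log_div hx0.ne' hκ.ne']
    linarith

/-- The constant `6` is a budget in powers of `exp x`: one for the users, two for the rounds, three
for `2 ^ m`. -/
theorem failure_le {x c β a T : ℝ} {m : ℕ} (hx : 1 ≤ x) (hT : T ≤ x ^ 2) (hm : (m : ℝ) ≤ 3 * x)
    (ha : β * a = (6 + c) * x) :
    exp x * T * (2 ^ m * exp (-(β * a))) ≤ exp (-c * x) := by
  have h1 : T ≤ exp (2 * x) := by
    have : x ≤ exp x := by linarith [add_one_le_exp x]
    calc T ≤ x ^ 2 := hT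
      _ ≤ exp x ^ 2 := by gcongr
      _ = exp (2 * x) := by rw [← exp_nat_mul]; norm_num
  have h2 : (2 : ℝ) ^ m ≤ exp (3 * x) := by
    calc (2 : ℝ) ^ m ≤ exp 1 ^ m := by gcongr; linarith [add_one_le_exp (1 : ℝ)]
      _ = exp m := by rw [← exp_nat_mul, mul_one]
      _ ≤ _ := exp_le_exp.2 hm
  calc exp x * T * (2 ^ m * exp (-(β * a)))
      ≤ exp x * exp (2 * x) * (exp (3 * x) * exp (-(β * a))) := by gcongr
    _ = exp (-c * x) := by
      rw [← exp_add, ← exp_add, ← exp_add, ha]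
      congr 1
      ring

/-- Blocks of length about `x` balance the two levels: about `x` blocks, and about `x` steps inside
one. -/
theorem card_chain_le_of_le {x : ℝ} (hx : 1 ≤ x) {T t : ℕ} (hT : (T : ℝ) ≤ x ^ 2) (ht : t ≤ T) :
    (chain ⌈x⌉₊ t).card ≤ ⌊3 * x⌋₊ := by
  refine Nat.le_floor ?_
  have h1 : ((chain ⌈x⌉₊ t).card : ℝ) ≤ ((t / (⌈x⌉₊ + 1) : ℕ) : ℝ) + (t % (⌈x⌉₊ + 1) : ℕ) := by
    exact_mod_cast card_chain_le ⌈x⌉₊ t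
  have h2 : ((t % (⌈x⌉₊ + 1) : ℕ) : ℝ) ≤ ⌈x⌉₊ := by
    exact_mod_cast Nat.lt_succ_iff.1 (Nat.mod_lt t (Nat.succ_pos _))
  have h3 : ((t / (⌈x⌉₊ + 1) : ℕ) : ℝ) ≤ x := by
    refine Nat.cast_div_le.trans ?_
    have h4 : x ≤ ⌈x⌉₊ := Nat.le_ceil x
    have h5 : (t : ℝ) ≤ x ^ 2 := le_trans (by exact_mod_cast ht) hT
    rw [div_le_iff₀ (by positivity)]
    push_cast
    nlinarith
  have h6 := Nat.ceil_lt_add_one (show 0 ≤ x by linarith)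
  linarith

theorem searchMechanism_isMemoryless (n l : ℕ) (lam : ℝ) (L R : ℕ) (β : ℝ) (hβ : 0 < β) :
    (searchMechanism n l lam L R β hβ).IsMemoryless :=
  noisyQueries_isMemoryless _ _ _ _

/-- Covers the small `n`, for which only privacy and memorylessness are required. -/
theorem exists_private_mechanism (n : ℕ) {ε : ℝ} (hε : 0 < ε) :
    ∃ M : LocalMechanism n, M.IsMemoryless ∧ M.IsEdgeDP ε := by
  refine ⟨searchMechanism n 0 1 1 1 (ε / 16) (by positivity),
    searchMechanism_isMemoryless _ _ _ _ _ _ _, ?_⟩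
  convert searchMechanism_isEdgeDP n 0 1 1 1 (ε / 16) (by positivity) using 1
  push_cast
  ring

/-- Only the noise rate depends on `ε`; stages, rounds and block length do not, so the bound on `n`
is uniform in `ε`. -/
theorem exists_accurate_mechanism (c : ℝ) (hc : 0 < c) {η : ℝ} (hη : 0 < η) :
    ∀ᶠ n : ℕ in atTop, ∀ ε : ℝ, 0 < ε → ∃ M : LocalMechanism n,
      (M.IsMemoryless ∧ M.IsEdgeDP ε) ∧
      ∃ R : ℕ, (R : ℝ) ≤ 1 * (logb (1 + η) n * log n) ∧ M.RunsWithin R ∧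
        ∀ G : SimpleGraph (Fin n),
          ENNReal.ofReal (1 - (n : ℝ) ^ (-c)) ≤ (M.transcriptLaw G R).toOuterMeasure
            {τ | ∀ v : Fin n,
              (coreness G v : ℝ)
                  - 256 * (6 + c) * (ε⁻¹ * log n * log (logb (1 + η) n)) ≤ M.output τ v ∧
              M.output τ v ≤ (2 + η) * (coreness G v : ℝ)
                  + 256 * (6 + c) * (ε⁻¹ * log n * log (logb (1 + η) n))} := by
  -- With `lam = 1 + δ` and `γ = δ` the multiplicative factor is `2 * (1 + δ) ^ 2 ≤ 2 + η`.
  set δ := min η 1 / 8 with hδ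
  have hmin : 0 < min η 1 := by positivity
  have hδ0 : 0 < δ := by positivity
  have hδ1 : 8 * δ ≤ 1 := by rw [hδ]; linarith [min_le_right η 1]
  have hδη : 8 * δ ≤ η := by rw [hδ]; linarith [min_le_left η 1]
  have hparam := eventually_parameters (κ := log (1 + η)) (lam := 1 + δ) (γ := δ)
    (log_pos (by linarith)) (by linarith) hδ0
  filter_upwards [(tendsto_log_atTop.comp tendsto_natCast_atTop_atTop).eventually hparam,
    eventually_ge_atTop 1] with n hn hn1 ε hε
  obtain ⟨hx, L, R, hL, hR, htop, hpow, hLR, hLR2, hLlog⟩ := hn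
  simp only [Function.comp_apply] at hx htop hpow hLR hLR2 hLlog
  set x := log (n : ℝ) with hxdef
  have hn0 : (0 : ℝ) < n := by exact_mod_cast hn1
  have hexp : exp x = n := exp_log hn0
  have hlogb : logb (1 + η) n = x / log (1 + η) := rfl
  have hLpos : (0 : ℝ) < L := by exact_mod_cast hL
  have hβ : 0 < ε / (16 * L) := by positivity
  -- This rate spends the privacy budget `16 * L * β` exactly; `256` below is `2 * 16 * 8`, where
  -- `8` comes from the bound on `L`.
  set β := ε / (16 * L) with hβdef
  set a := (6 + c) * x / β with hadef
  have ha : 0 ≤ a := by positivity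
  have hβa : β * a = (6 + c) * x := by rw [hadef]; field_simp
  have hα : 2 * a ≤ 256 * (6 + c) * (ε⁻¹ * x * log (logb (1 + η) n)) := by
    have e : 2 * a = 32 * (6 + c) * (ε⁻¹ * x) * L := by
      rw [hadef, hβdef]
      field_simp
      ring
    rw [e, hlogb]
    calc _ ≤ 32 * (6 + c) * (ε⁻¹ * x) * (8 * log (x / log (1 + η))) := by gcongr
      _ = _ := by ring
  refine ⟨searchMechanism n ⌈x⌉₊ (1 + δ) L R β hβ,
    ⟨searchMechanism_isMemoryless _ _ _ _ _ _ _, ?_⟩, L * R, ?_,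
    noisyQueries_runsWithin _ _ _ _ (Nat.mul_pos hL hR), fun G => ?_⟩
  · convert searchMechanism_isEdgeDP n ⌈x⌉₊ (1 + δ) L R β hβ using 1
    rw [hβdef]
    field_simp
  · rw [hlogb]
    push_cast
    linarith
  · have hacc := searchMechanism_accurate (n := n) (l := ⌈x⌉₊) (lam := 1 + δ) hL hR hβ
      (by linarith) (by linarith) hδ0 ha (hexp ▸ htop) (hexp ▸ hpow) (m := ⌊3 * x⌋₊)
      (fun t ht => card_chain_le_of_le hx (T := L * R) (by push_cast; exact hLR2) ht) G
    have hfail := failure_le (c := c) hx hLR2 (Nat.floor_le (show 0 ≤ 3 * x by linarith)) hβa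
    rw [hexp] at hfail
    have hpowc : (n : ℝ) ^ (-c) = exp (-c * x) := by
      rw [rpow_def_of_pos hn0, mul_comm]
    refine (ENNReal.ofReal_le_ofReal ?_).trans (hacc.trans (MeasureTheory.measure_mono ?_))
    · rw [hpowc]
      linarith
    · intro τ hτ v
      obtain ⟨h1, h2⟩ := hτ v
      refine ⟨by linarith, h2.trans (add_le_add ?_ hα)⟩
      gcongr
      nlinarith

end LocalDP

theorem mainTheorem2 :
    ∃ A : ℝ, 0 < A ∧ ∀ c : ℝ, 0 < c → ∃ B : ℝ, 0 < B ∧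
      ∀ η : ℝ, 0 < η → ∃ n₀ : ℕ, ∀ ε : ℝ, 0 < ε →
        ∃ M : (n : ℕ) → LocalDP.LocalMechanism n,
          (∀ n : ℕ, (M n).IsMemoryless ∧ (M n).IsEdgeDP ε) ∧
          ∀ n : ℕ, n₀ ≤ n →
            ∃ R : ℕ, (R : ℝ) ≤ A * (Real.logb (1 + η) n * Real.log n) ∧
              (M n).RunsWithin R ∧
              ∀ G : SimpleGraph (Fin n),
                ENNReal.ofReal (1 - (n : ℝ) ^ (-c)) ≤
                  ((M n).transcriptLaw G R).toOuterMeasure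
                    {τ | ∀ v : Fin n,
                      (LocalDP.coreness G v : ℝ)
                          - B * (ε⁻¹ * Real.log n * Real.log (Real.logb (1 + η) n))
                        ≤ (M n).output τ v ∧
                      (M n).output τ v ≤ (2 + η) * (LocalDP.coreness G v : ℝ)
                          + B * (ε⁻¹ * Real.log n * Real.log (Real.logb (1 + η) n))} := by
  refine ⟨1, one_pos, fun c hc => ⟨256 * (6 + c), by positivity, fun η hη => ?_⟩⟩
  obtain ⟨n₀, hn₀⟩ := Filter.eventually_atTop.1 (LocalDP.exists_accurate_mechanism c hc hη)
  refine ⟨n₀, fun ε hε => ?_⟩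
  have hM : ∀ n : ℕ, ∃ M : LocalDP.LocalMechanism n, (M.IsMemoryless ∧ M.IsEdgeDP ε) ∧
      (n₀ ≤ n → _) := fun n => by
    by_cases hn : n₀ ≤ n
    · obtain ⟨M, hM, h⟩ := hn₀ n hn ε hε
      exact ⟨M, hM, fun _ => h⟩
    · obtain ⟨M, hM⟩ := LocalDP.exists_private_mechanism n hε
      exact ⟨M, hM, fun h => absurd h hn⟩
  choose M hM using hM
  exact ⟨M, fun n => (hM n).1, fun n hn => (hM n).2 hn⟩
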